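/- Let $p\ge 0$ and $n\ge 1$ be integers and put $$\gamma=40\sqrt{\tfrac{\ln n}{n}},\quad k=\Big\lfloor (0.1/\gamma)^{2/3}\Big\rfloor,\quad \alpha=p+1,\quad \rho=\frac{\gamma}{100\,\alpha\ln n},\quad \beta=\frac{\gamma}{\ln n},\quad \epsilon=\frac{0.1}{\sqrt k},$$ where $n$ is large enough that $k\ge 1$ (for $k=0$ nothing is asserted). For orthonormal $V=(v_1,\dots,v_k)$ in $\mathbb{R}^n$ and $1\le i\le k$ let $$f_i(x)=\rho\ln\Big(\sum_{j=1}^{i}\exp\Big(\frac{\langle v_j,x\rangle+(k-j)\gamma}{\rho}\Big)\Big)+\rho\,(k-i)\,n^{-\alpha},\qquad h_i(x)=\max_{1\le j\le i}f_j(x),$$ $$g_i=S_{\beta/2^p}\big[S_{\beta/2^{p-1}}[\cdots S_{\beta/2}[h_i]\cdots]\big],\qquad S_\eta[f](x)=\text{the mean of } f \text{ over the ball } \{y:\|y-x\|\le\eta\}$$ (so $g_i=h_i$ if $p=0$), where $\|\cdot\|$ is the Euclidean norm. Let $V$ be Haar-random, i.e. the image of the first $k$ standard basis vectors under a Haar-random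 element of the orthogonal group $O(n)$. Then every $g_i$ ($1\le i\le k$) is $p$ times continuously differentiable, and $g_1,\dots,g_k$ is a $k$-step $(n^{-10},n^{-10})$-information-hiding class of functions on the unit ball for queries that return the value and all derivatives up to order $p$, $\mathsf Q_f(x)=(f(x),\nabla f(x),\dots,\nabla^p f(x))$, where a correct output for $f$ is an $\epsilon$-approximate minimum in the unit ball, i.e. a point $x$ with $\|x\|\le 1$ and $f(x)\le\min_{\|y\|\le 1}f(y)+\epsilon$. Explicitly: $g_i$ is determined by $v_1,\dots,v_i$, and 1. for all $1\le i<k$, every orthonormal setting of $v_1,\dots,v_{i-1}$, and every $x$ with $\|x\|\le 1$, $$\Pr_{v_i,\dots,v_k\,|\,v_1,\dots,v_{i-1}}\big(\mathsf Q_{g_k}(x)=\mathsf Q_{g_i}(x)\big)\ge 1-n^{-10};$$ 2. for every orthonormal setting of $v_1,\dots,v_{k-1}$ and every $x\in\mathbb{R}^n$, $$\Pr_{v_k\,|\,v_1,\dots,v_{k-1}}\big(x\text{ is a correct output for }g_k\big)\le n^{-10}.$$ Here the conditional law of $V$ given $v_1,\dots,v_t$ is the regular conditional distribution given, at every setting,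 by the Haar distribution on the orthonormal lists that begin with $v_1,\dots,v_t$, i.e. by applying to any one such list a Haar-random orthogonal transformation that fixes $v_1,\dots,v_t$. -/

import Mathlib

open MeasureTheory

noncomputable section

namespace HiddenOpt

/-- Euclidean space `ℝⁿ`. -/
abbrev E (n : ℕ) : Type := EuclideanSpace ℝ (Fin n)

/-! ### Information-hiding classes of functions -/

/-- The σ-algebra generated by the first `t` of the random variables `R 0, …, R (m-1)`. -/
abbrev pastSigma {Ω X : Type*} [MeasurableSpace X] {m : ℕ} (R : Fin m → Ω → X) (t : ℕ) :
    MeasurableSpace Ω :=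
  MeasurableSpace.comap (fun ω (j : {j : Fin m // (j : ℕ) < t}) => R j ω) inferInstance

/-- `κ` is a regular conditional distribution under `μ` given the values of the first `t` of the
random variables `R 0, …, R (m-1)`, and for every setting of these values it is carried by the
outcomes that have this setting. -/
structure IsCondLaw {Ω X : Type*} [MeasurableSpace Ω] [MeasurableSpace X] {m : ℕ}
    (μ : Measure Ω) (R : Fin m → Ω → X) (t : ℕ) (κ : Ω → Measure Ω) : Prop where
  isProb : ∀ ω, IsProbabilityMeasure (κ ω)
  measurable_past : ∀ A, MeasurableSet A → Measurable[pastSigma R t] (fun ω => κ ω A)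
  disintegrates : ∀ A B, MeasurableSet A → MeasurableSet[pastSigma R t] B →
    ∫⁻ ω in B, κ ω A ∂μ = μ (A ∩ B)
  fiber : ∀ ω, κ ω {ω' | ∀ j : Fin m, (j : ℕ) < t → R j ω' = R j ω}ᶜ = 0

/-- `m`-step `(δ₁, δ₂)`-information-hiding.  The random variables `R 0, …, R (m-1)` are the
`ℛ₁, …, ℛ_m` of the usual one-based numbering, `f i` (for `1 ≤ i ≤ m`) is the `i`-th function,
`κ t ω` is the conditional law of the outcome given that the first `t` of the random variables
have the values they have at `ω`, `oracle F x` is the answer to the query `x` about `F`, `D` is the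
set of admissible queries, and `correct F x` says that `x` is a correct output for `F`.
In `hides`, the number `t + 1` is the index `i` with `1 ≤ i < m`, and the probability of equal
answers being at least `1 - δ₁` is expressed by the complementary event (so that nothing is left
open about events whose measurability is not evident). -/
structure IsInformationHiding {Ω X Y Ans : Type*} [MeasurableSpace Ω] [MeasurableSpace X]
    (m : ℕ) (μ : Measure Ω) (R : Fin m → Ω → X) (κ : ℕ → Ω → Measure Ω)
    (f : ℕ → Ω → Y → ℝ) (oracle : (Y → ℝ) → Y → Ans) (D : Set Y)
    (correct : (Y → ℝ) → Y → Prop) (δ₁ δ₂ : ℝ) : Prop where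
  isProb : IsProbabilityMeasure μ
  measurable : ∀ j, Measurable (R j)
  determined : ∀ i, 1 ≤ i → i ≤ m → ∀ ω ω', (∀ j : Fin m, (j : ℕ) < i → R j ω = R j ω') →
    f i ω = f i ω'
  condLaw : ∀ t, t < m → IsCondLaw μ R t (κ t)
  hides : ∀ t, t + 1 < m → ∀ ω, ∀ x ∈ D,
    (κ t ω).real {ω' | oracle (f m ω') x ≠ oracle (f (t + 1) ω') x} ≤ δ₁
  hard : ∀ t, t + 1 = m → ∀ ω, ∀ x,
    (κ t ω).real {ω' | correct (f m ω') x} ≤ δ₂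

/-! ### Haar-random orthonormal vectors -/

/-- The orthogonal group of `ℝⁿ`. -/
abbrev O (n : ℕ) : Type := unitary (E n →L[ℝ] E n)

/-- Lists of `k` orthonormal vectors in `ℝⁿ`. -/
abbrev Frame (n k : ℕ) : Type := {V : Fin k → E n // Orthonormal ℝ V}

instance (n : ℕ) : ContinuousStar (E n →L[ℝ] E n) := 
  ⟨(ContinuousLinearMap.adjoint (𝕜 := ℝ) (E := E n) (F := E n)).continuous⟩

theorem isCompact_unitary (n : ℕ) :
    IsCompact ((unitary (E n →L[ℝ] E n) : Submonoid (E n →L[ℝ] E n)) : Set (E n →L[ℝ] E n)) := by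
  have : ProperSpace (E n →L[ℝ] E n) := FiniteDimensional.proper ℝ _
  refine Metric.isCompact_of_isClosed_isBounded isClosed_unitary ?_
  refine (Metric.isBounded_closedBall (x := (0 : E n →L[ℝ] E n)) (r := 1)).subset ?_
  intro Q hQ
  rw [mem_closedBall_zero_iff]
  refine ContinuousLinearMap.opNorm_le_bound _ zero_le_one fun x => ?_
  rw [one_mul]
  exact (Unitary.norm_map ⟨Q, hQ⟩ x).le

instance (n : ℕ) : CompactSpace (O n) := isCompact_iff_compactSpace.mp (isCompact_unitary n)

/-- The rotated frame `(Q v₁, …, Q v_k)`. -/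
def rotate {n k : ℕ} (Q : O n) (V : Frame n k) : Frame n k :=
  ⟨fun j => (Q : E n →L[ℝ] E n) (V.1 j),
    V.2.comp_linearIsometry (Unitary.linearIsometryEquiv Q).toLinearIsometry⟩

/-- The orthogonal transformations that fix the first `t` vectors of the frame `V`. -/
def fixer {n k : ℕ} (V : Frame n k) (t : ℕ) : Subgroup (O n) where
  carrier := {Q | ∀ j : Fin k, (j : ℕ) < t → (Q : E n →L[ℝ] E n) (V.1 j) = V.1 j}
  one_mem' := by intro j _; simp
  mul_mem' := by
    intro P Q hP hQ j hj
    simp [hQ j hj, hP j hj]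
  inv_mem' := by
    intro Q hQ j hj
    have h : ((Q⁻¹ * Q : O n) : E n →L[ℝ] E n) (V.1 j) = V.1 j := by
      rw [inv_mul_cancel]; rfl
    have h' : ((Q⁻¹ : O n) : E n →L[ℝ] E n) ((Q : E n →L[ℝ] E n) (V.1 j)) = V.1 j := h
    rwa [hQ j hj] at h'

instance {n k : ℕ} (V : Frame n k) (t : ℕ) : CompactSpace (fixer V t) := by
  refine isCompact_iff_compactSpace.mp (IsClosed.isCompact ?_)
  have : ((fixer V t : Subgroup (O n)) : Set (O n)) =
      ⋂ (j : Fin k) (_ : (j : ℕ) < t), {Q : O n | (Q : E n →L[ℝ] E n) (V.1 j) = V.1 j} := by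
    ext Q
    simp [fixer]
  rw [this]
  refine isClosed_iInter fun j => isClosed_iInter fun _ => isClosed_eq ?_ continuous_const
  exact (ContinuousLinearMap.apply ℝ (E n) (V.1 j)).continuous.comp continuous_subtype_val

/-- The frame of the first `k` standard basis vectors. -/
def stdFrame {n k : ℕ} (h : k ≤ n) : Frame n k :=
  ⟨fun j => EuclideanSpace.basisFun (Fin n) ℝ (Fin.castLE h j),
    (EuclideanSpace.basisFun (Fin n) ℝ).orthonormal.comp _ (Fin.castLE_injective h)⟩

/-- The Haar distribution on lists of `k` orthonormal vectors: the image of the standard frame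
under a Haar-random element of the orthogonal group. -/
def haarFrame {n k : ℕ} (h : k ≤ n) : Measure (Frame n k) :=
  (Measure.haarMeasure (⊤ : TopologicalSpace.PositiveCompacts (O n))).map
    (fun Q : O n => rotate Q (stdFrame h))

/-- The Haar distribution on the frames that have the same first `t` vectors as `V`: the image of
`V` under a Haar-random orthogonal transformation among those that fix these `t` vectors. -/
def haarFrameGiven {n k : ℕ} (t : ℕ) (V : Frame n k) : Measure (Frame n k) :=
  (Measure.haarMeasure (⊤ : TopologicalSpace.PositiveCompacts (fixer V t))).map
    (fun Q : fixer V t => rotate (Q : O n) V)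

/-! ### The parameters -/

/-- `γ = 40 √(ln n / n)`. -/
def gam (n : ℕ) : ℝ := 40 * √(Real.log n / n)

/-- `k = ⌊(0.1 / γ) ^ (2/3)⌋`. -/
def kk (n : ℕ) : ℕ := ⌊(0.1 / gam n) ^ (2 / 3 : ℝ)⌋₊

/-- `α = p + 1`. -/
def alp (p : ℕ) : ℝ := p + 1

/-- `ρ = γ / (100 α ln n)`. -/
def rho (n p : ℕ) : ℝ := gam n / (100 * alp p * Real.log n)

/-- `β = γ / ln n`. -/
def bet (n : ℕ) : ℝ := gam n / Real.log n

/-- `ε = 0.1 / √k`. -/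
def eps (n : ℕ) : ℝ := 0.1 / √(kk n)

theorem kk_le (n : ℕ) : kk n ≤ n := by
  unfold kk
  rcases Nat.lt_or_ge n 2 with hn | hn
  · have h0 : gam n = 0 := by
      interval_cases n <;> simp [gam]
    rw [h0]
    norm_num
  · have hn' : (2 : ℝ) ≤ n := by exact_mod_cast hn
    have hlog : (1 / 4 : ℝ) ≤ Real.log n := by
      have h1 := Real.log_two_gt_d9
      have h2 := Real.log_le_log (by norm_num) hn'
      linarith
    have hsq : 1 / (2 * (n : ℝ)) ≤ √(Real.log n / n) := by
      apply Real.le_sqrt_of_sq_le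
      rw [div_pow, div_le_div_iff₀ (by positivity) (by positivity)]
      nlinarith [mul_le_mul_of_nonneg_right hlog (by positivity : (0 : ℝ) ≤ 4 * (n : ℝ) ^ 2)]
    have hg : 20 / (n : ℝ) ≤ gam n := by
      have h3 : 20 / (n : ℝ) = 40 * (1 / (2 * (n : ℝ))) := by field_simp; norm_num
      rw [h3, gam]
      linarith
    have hq : 0.1 / gam n ≤ n := by
      have h4 : (0 : ℝ) < 20 / n := by positivity
      rw [div_le_iff₀ (lt_of_lt_of_le h4 hg)]
      have h5 : (n : ℝ) * (20 / n) = 20 := by field_simp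
      nlinarith [mul_le_mul_of_nonneg_left hg (by positivity : (0 : ℝ) ≤ n)]
    have hg0 : 0 ≤ gam n := by unfold gam; positivity
    apply Nat.floor_le_of_le
    calc (0.1 / gam n) ^ (2 / 3 : ℝ) ≤ (n : ℝ) ^ (2 / 3 : ℝ) :=
          Real.rpow_le_rpow (by positivity) hq (by norm_num)
      _ ≤ (n : ℝ) ^ (1 : ℝ) := Real.rpow_le_rpow_of_exponent_le (by linarith) (by norm_num)
      _ = n := Real.rpow_one _

/-! ### The functions -/

/-- Randomized smoothing: the mean of `F` over the ball of radius `η` around `x`. -/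
def ballSmooth {n : ℕ} (η : ℝ) (F : E n → ℝ) : E n → ℝ :=
  fun x => ⨍ y in Metric.closedBall x η, F y

/-- The `p`-fold smoothing `S_{b/2^p}[⋯ S_{b/2²}[S_{b/2¹}[F]] ⋯]`. -/
def smooth {n : ℕ} (b : ℝ) : ℕ → (E n → ℝ) → E n → ℝ
  | 0, F => F
  | p + 1, F => ballSmooth (b / 2 ^ (p + 1)) (smooth b p F)

/-- The softmax of the first `i` coordinates of `z`. -/
def smaxLE {k : ℕ} (r : ℝ) (i : ℕ) (z : Fin k → ℝ) : ℝ :=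
  r * Real.log (∑ j ∈ Finset.univ.filter (fun j : Fin k => (j : ℕ) < i), Real.exp (z j / r))

/-- `vec_V(x) = (⟨v₁, x⟩ + (k-1)γ, …, ⟨v_k, x⟩ + (k-k)γ)`. -/
def vecV {n k : ℕ} (V : Frame n k) (x : E n) : Fin k → ℝ :=
  fun j => inner ℝ (V.1 j) x + ((k : ℝ) - ((j : ℕ) + 1)) * gam n

/-- `f_i(x) = smax^{≤ i}_ρ(vec_V(x)) + ρ (k - i) n^{-α}`, for `1 ≤ i ≤ k`. -/
def fFun {n k : ℕ} (p i : ℕ) (V : Frame n k) (x : E n) : ℝ :=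
  smaxLE (rho n p) i (vecV V x) + rho n p * ((k : ℝ) - i) * (n : ℝ) ^ (-alp p)

/-- `h_i(x) = max_{1 ≤ j ≤ i} f_j(x)`, for `1 ≤ i ≤ k`. -/
def hFun {n k : ℕ} (p i : ℕ) (V : Frame n k) (x : E n) : ℝ :=
  ⨆ j : Fin i, fFun p ((j : ℕ) + 1) V x

/-- `g_i` is the `p`-fold smoothing of `h_i` with parameter `β`, for `1 ≤ i ≤ k`. -/
def gFun {n k : ℕ} (p i : ℕ) (V : Frame n k) : E n → ℝ :=
  smooth (bet n) p (hFun p i V)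

/-! ### Queries and outputs -/

/-- The answer `(F x, ∇F x, …, ∇^p F x)` of the `p`-th order oracle. -/
def oracle {n : ℕ} (p : ℕ) (F : E n → ℝ) (x : E n) :
    (j : Fin (p + 1)) → ContinuousMultilinearMap ℝ (fun _ : Fin (j : ℕ) => E n) ℝ :=
  fun j => iteratedFDeriv ℝ (j : ℕ) F x

/-- `x` is an `e`-approximate minimum of `F` in the unit ball. -/
def IsApproxMin {n : ℕ} (e : ℝ) (F : E n → ℝ) (x : E n) : Prop :=
  x ∈ Metric.closedBall (0 : E n) 1 ∧ ∀ y ∈ Metric.closedBall (0 : E n) 1, F x ≤ F y + e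

end HiddenOpt

end

/-! Fix the first `t` vectors. Each later `v_j` is spread evenly over the unit sphere of their
orthogonal complement, so for `‖x‖ ≤ 1` a union bound gives `|⟨v_j, x⟩| < γ/4` for all of them,
outside an event of probability at most `2k·exp(-(n-t)γ²/32) ≤ n^{-10}`.

Hiding: on this event, at every point within `β ≤ γ/8` of `x`, the shift `γ` between consecutive
coordinates keeps coordinate `t+1` (one-based) above each later one by at least `γ - 2(γ/4 + γ/8) =
γ/4`. Each later term then raises the softmax by at most `ρ n^{-α}`, exactly what the additive
correction loses at that step. Hence `h_k = h_{t+1}` on this ball. The smoothing radii add up to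
less than `β`, so `g_k` and `g_{t+1}` agree near `x`, together with all derivatives
(`oracle_gFun_eq_of_small`).

Hardness: at `-∑ v_j/√k` the value of `g_k` is at most `-1/√k + kγ`, while `g_k(x) ≥ ⟨v_k, x⟩`
everywhere. As `kγ` and `ε` are at most `0.1/√k`, a correct output satisfies `⟨v_k, x⟩ ≤ -0.8/√k`,
which is again the rare event (`le_abs_inner_of_isApproxMin`).

Regularity: `h_i` is 1-Lipschitz, and each ball average gains one derivative
(`LipschitzDerivs.ballMean`).

Conditional law: for independent Haar `P` in `O(n)` and `Q` in the stabilizer of the first `t`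
vectors, `PQ` is Haar, and `Q` only resamples the later vectors (`isCondLaw_haarFrameGiven`). -/

open MeasureTheory

noncomputable section

namespace HiddenOpt

/-! ### Haar probability on compact groups -/

section CompactGroup

variable {G : Type*} [Group G] [TopologicalSpace G] [IsTopologicalGroup G] [CompactSpace G]
  [MeasurableSpace G] [BorelSpace G]

/-- The Haar probability measure of a compact group. -/
abbrev haarProb (G : Type*) [Group G] [TopologicalSpace G] [IsTopologicalGroup G] [CompactSpace G]
    [MeasurableSpace G] [BorelSpace G] : Measure G :=
  Measure.haarMeasure (⊤ : TopologicalSpace.PositiveCompacts G)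

instance isProbabilityMeasure_haarProb : IsProbabilityMeasure (haarProb G) :=
  ⟨by simpa using Measure.haarMeasure_self (K₀ := (⊤ : TopologicalSpace.PositiveCompacts G))⟩

theorem eq_haarProb [SecondCountableTopology G] (μ : Measure G) [IsProbabilityMeasure μ]
    [μ.IsMulLeftInvariant] : μ = haarProb G := by
  have h := Measure.haarMeasure_unique μ (⊤ : TopologicalSpace.PositiveCompacts G)
  simpa using h

/-- Unimodularity: a right translate is still a left-invariant probability measure, hence Haar by
uniqueness. -/
theorem map_mul_right_haarProb [SecondCountableTopology G] (g : G) :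
    (haarProb G).map (fun x => x * g) = haarProb G := by
  have : IsProbabilityMeasure ((haarProb G).map (fun x => x * g)) :=
    Measure.isProbabilityMeasure_map (measurable_mul_const g).aemeasurable
  exact eq_haarProb _

theorem map_mulEquiv_haarProb {H : Type*} [Group H] [TopologicalSpace H] [IsTopologicalGroup H]
    [CompactSpace H] [MeasurableSpace H] [BorelSpace H] [SecondCountableTopology H]
    (e : G ≃* H) (he : Continuous e) : (haarProb G).map e = haarProb H := by
  have : IsProbabilityMeasure ((haarProb G).map e) :=
    Measure.isProbabilityMeasure_map he.measurable.aemeasurable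
  have : ((haarProb G).map e).IsMulLeftInvariant :=
    isMulLeftInvariant_map (e : G →ₙ* H) he.measurable e.surjective
  exact eq_haarProb _

end CompactGroup

/-! ### Random frames and their conditional laws -/

theorem exists_rotate_eq {n k : ℕ} (V W : Frame n k) : ∃ P : O n, rotate P V = W := by
  have hk : k ≤ n := by
    simpa using V.2.linearIndependent.fintype_card_le_finrank
  -- Both frames extend to orthonormal bases, and the isometry matching the bases matches the
  -- frames.
  have key : ∀ U : Frame n k, ∃ b : OrthonormalBasis (Fin n) ℝ (E n),
      ∀ j : Fin k, b (Fin.castLE hk j) = U.1 j := by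
    intro U
    let u : Fin n → E n := fun i => if hi : (i : ℕ) < k then U.1 ⟨i, hi⟩ else 0
    have hu : Orthonormal ℝ (Set.domRestrict {i : Fin n | (i : ℕ) < k} u) := by
      have : Set.domRestrict {i : Fin n | (i : ℕ) < k} u =
          U.1 ∘ fun i : {i : Fin n | (i : ℕ) < k} => (⟨i.1, i.2⟩ : Fin k) := by
        funext i
        have hi : ((i : Fin n) : ℕ) < k := i.2
        simp only [Set.domRestrict_apply, u, Function.comp_apply, dif_pos hi]
      rw [this]
      refine U.2.comp _ fun i j hij => ?_
      simpa [Subtype.ext_iff, Fin.ext_iff] using hij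
    obtain ⟨b, hb⟩ := hu.exists_orthonormalBasis_extension_of_card_eq (by simp)
    refine ⟨b, fun j => ?_⟩
    rw [hb _ (by simp)]
    simp [u]
  obtain ⟨b, hb⟩ := key V
  obtain ⟨c, hc⟩ := key W
  refine ⟨Unitary.linearIsometryEquiv.symm (b.equiv c (Equiv.refl _)), Subtype.ext ?_⟩
  funext j
  change (b.equiv c (Equiv.refl _)) (V.1 j) = W.1 j
  rw [← hb, ← hc, OrthonormalBasis.equiv_apply_basis, Equiv.refl_apply]

theorem rotate_mul {n k : ℕ} (P Q : O n) (V : Frame n k) :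
    rotate (P * Q) V = rotate P (rotate Q V) := rfl

theorem rotate_fixer_apply {n k t : ℕ} {V : Frame n k} (P : O n) (Q : fixer V t) {j : Fin k}
    (hj : (j : ℕ) < t) : (rotate (P * Q.1) V).1 j = (rotate P V).1 j :=
  congrArg (P : E n →L[ℝ] E n) (Q.2 j hj)

theorem continuous_rotate {n k : ℕ} (V : Frame n k) : Continuous fun Q : O n => rotate Q V := by
  refine Continuous.subtype_mk (continuous_pi fun j => ?_) _
  exact (ContinuousLinearMap.apply ℝ (E n) (V.1 j)).continuous.comp continuous_subtype_val

/-- Needed in `measurable_haarFrameGiven`, where measurability descends along a Borel map defined on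
`O n`. -/
instance polishSpace_O (n : ℕ) : PolishSpace (O n) := by
  have : CompleteSpace (O n) := complete_of_compact
  infer_instance

theorem continuous_rotate_mul {n k : ℕ} (V : Frame n k) (t : ℕ) :
    Continuous fun z : O n × fixer V t => rotate (z.1 * z.2.1) V :=
  (continuous_rotate V).comp (continuous_fst.mul (continuous_subtype_val.comp continuous_snd))

/-- Conjugation by `P` carries the stabilizer for `V` to the one for the rotated frame. -/
def fixerConj {n k : ℕ} (P : O n) (V : Frame n k) (t : ℕ) :
    fixer V t ≃* fixer (rotate P V) t where
  toFun Q := ⟨P * Q.1 * P⁻¹, by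
    intro j hj
    have h : rotate (P * Q.1 * P⁻¹) (rotate P V) = rotate (P * Q.1) V := by
      rw [← rotate_mul, inv_mul_cancel_right]
    exact (congrArg (fun W => W.1 j) h).trans (rotate_fixer_apply P Q hj)⟩
  invFun Q := ⟨P⁻¹ * Q.1 * P, by
    intro j hj
    have h : rotate (P⁻¹ * Q.1 * P) V = rotate (P⁻¹ * Q.1) (rotate P V) := rfl
    have h' : rotate P⁻¹ (rotate P V) = V := by
      rw [← rotate_mul, inv_mul_cancel]; rfl
    refine (congrArg (fun W => W.1 j) h).trans ((rotate_fixer_apply P⁻¹ Q hj).trans ?_)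
    rw [h']⟩
  left_inv Q := Subtype.ext (by simp [mul_assoc])
  right_inv Q := Subtype.ext (by simp [mul_assoc])
  map_mul' Q R := Subtype.ext (by simp [mul_assoc])

/-- Conjugation by `P` carries Haar to Haar, and `P Q P⁻¹` sends `P V` to `P Q V`. All conditional
laws thus come from one fixed stabilizer. -/
theorem haarFrameGiven_rotate {n k : ℕ} (t : ℕ) (P : O n) (V : Frame n k) :
    haarFrameGiven t (rotate P V) =
      (haarProb (fixer V t)).map (fun Q : fixer V t => rotate (P * Q.1) V) := by
  have hc : Continuous (fixerConj P V t) := by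
    refine Continuous.subtype_mk ?_ _
    exact (continuous_const.mul continuous_subtype_val).mul continuous_const
  have hr : Measurable fun Q : fixer (rotate P V) t => rotate (Q : O n) (rotate P V) :=
    ((continuous_rotate _).comp continuous_subtype_val).measurable
  change (haarProb _).map _ = _
  rw [← map_mulEquiv_haarProb (fixerConj P V t) hc, Measure.map_map hr hc.measurable]
  congr 1
  funext Q
  change rotate (P * Q.1 * P⁻¹) (rotate P V) = _
  rw [← rotate_mul, inv_mul_cancel_right]

theorem haarFrameGiven_rotate_apply {n k : ℕ} (t : ℕ) (P : O n) (V : Frame n k)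
    {A : Set (Frame n k)} (hA : MeasurableSet A) :
    haarFrameGiven t (rotate P V) A =
      haarProb (fixer V t) {Q : fixer V t | rotate (P * Q.1) V ∈ A} := by
  rw [haarFrameGiven_rotate, Measure.map_apply _ hA]
  · rfl
  · exact ((continuous_rotate_mul V t).comp (Continuous.prodMk_right P)).measurable

theorem measurable_rotate_fixer {n k : ℕ} (t : ℕ) (V : Frame n k) :
    Measurable fun Q : fixer V t => rotate (Q : O n) V :=
  ((continuous_rotate V).comp continuous_subtype_val).measurable

instance isProbabilityMeasure_haarFrameGiven {n k : ℕ} (t : ℕ) (V : Frame n k) :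
    IsProbabilityMeasure (haarFrameGiven t V) :=
  Measure.isProbabilityMeasure_map (measurable_rotate_fixer t V).aemeasurable

instance isProbabilityMeasure_haarFrame {n k : ℕ} (h : k ≤ n) :
    IsProbabilityMeasure (haarFrame h) :=
  Measure.isProbabilityMeasure_map (continuous_rotate _).measurable.aemeasurable

theorem measurable_frame_apply {n k : ℕ} (j : Fin k) :
    Measurable fun V : Frame n k => V.1 j :=
  (measurable_pi_apply j).comp measurable_subtype_coe

/-- The rotation taking `V` to `W` lies in the stabilizer, where left invariance absorbs it. -/
theorem haarFrameGiven_congr {n k t : ℕ} {V W : Frame n k}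
    (h : ∀ j : Fin k, (j : ℕ) < t → V.1 j = W.1 j) {A : Set (Frame n k)} (hA : MeasurableSet A) :
    haarFrameGiven t V A = haarFrameGiven t W A := by
  obtain ⟨R, hR⟩ := exists_rotate_eq V W
  have hR' : R ∈ fixer V t := fun j hj => by
    exact (congrArg (fun U => U.1 j) hR).trans (h j hj).symm
  have hV : rotate 1 V = V := rfl
  rw [← hR, haarFrameGiven_rotate_apply t R V hA]
  conv_lhs => rw [← hV, haarFrameGiven_rotate_apply t 1 V hA]
  have hm : Measurable fun Q : fixer V t => rotate (1 * Q.1) V :=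
    ((continuous_rotate_mul V t).comp (Continuous.prodMk_right 1)).measurable
  rw [← measure_preimage_mul (haarProb (fixer V t)) ⟨R, hR'⟩]
  simp only [Set.preimage_ofPred_eq, one_mul, Subgroup.coe_mul]

/-- Lifted to `O n`, the map is measurable by Fubini and factors through the first `t` vectors. A
Borel function on a Polish space that factors through a Borel map has a Borel factor on the range.
-/
theorem measurable_haarFrameGiven {n k : ℕ} (h : k ≤ n) (t : ℕ) {A : Set (Frame n k)}
    (hA : MeasurableSet A) :
    Measurable[pastSigma (fun j (V : Frame n k) => V.1 j) t] (fun V => haarFrameGiven t V A) := by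
  let V₀ : Frame n k := stdFrame h
  let past : Frame n k → ({j : Fin k // (j : ℕ) < t} → E n) := fun V j => V.1 j
  let π : O n → ({j : Fin k // (j : ℕ) < t} → E n) := fun P => past (rotate P V₀)
  have hπ : Measurable π := by
    refine measurable_pi_lambda _ fun j => ?_
    exact (measurable_frame_apply j.1).comp (continuous_rotate V₀).measurable
  let G : O n → ENNReal := fun P => haarFrameGiven t (rotate P V₀) A
  have hG : Measurable G := by
    have : G = fun P => haarProb (fixer V₀ t)
        (Prod.mk P ⁻¹' ((fun z : O n × fixer V₀ t => rotate (z.1 * z.2.1) V₀) ⁻¹' A)) := by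
      funext P
      exact haarFrameGiven_rotate_apply t P V₀ hA
    rw [this]
    exact measurable_measure_prodMk_left ((continuous_rotate_mul V₀ t).measurable hA)
  -- The default 0 is harmless: `g` is only used on the range of `π`, which contains every possible
  -- past.
  let g : ({j : Fin k // (j : ℕ) < t} → E n) → ENNReal := Function.extend π G fun _ => 0
  have hgπ : g ∘ π = G := by
    have hfac : G.FactorsThrough π := fun P Q hPQ =>
      haarFrameGiven_congr (fun j hj => congrFun hPQ ⟨j, hj⟩) hA
    funext P
    exact hfac.extend_apply (fun _ => 0) P
  have hg := (hπ.measurable_comp_iff_restrict (g := g)).1 (hgπ ▸ hG)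
  have hr : ∀ V, past V ∈ Set.range π := fun V => by
    obtain ⟨P, hP⟩ := exists_rotate_eq V₀ V
    exact ⟨P, by simp only [π, hP]⟩
  have hf : (fun V => haarFrameGiven t V A) =
      fun V => Set.domRestrict (Set.range π) g ⟨past V, hr V⟩ := by
    funext V
    obtain ⟨P, hP⟩ := exists_rotate_eq V₀ V
    have h1 := congrFun hgπ P
    simp only [Function.comp_apply, π, G, hP] at h1
    exact h1.symm
  rw [hf]
  exact hg.comp (Measurable.subtype_mk (comap_measurable past))

theorem isCondLaw_haarFrameGiven {n k : ℕ} (h : k ≤ n) (t : ℕ) :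
    IsCondLaw (haarFrame h) (fun j (V : Frame n k) => V.1 j) t (haarFrameGiven t) where
  isProb _ := inferInstance
  measurable_past _ hA := measurable_haarFrameGiven h t hA
  disintegrates A B hA hB := by
    let V₀ : Frame n k := stdFrame h
    have hle : pastSigma (fun j (V : Frame n k) => V.1 j) t ≤
        (inferInstance : MeasurableSpace (Frame n k)) :=
      Measurable.comap_le (measurable_pi_lambda _ fun j => measurable_frame_apply j.1)
    have hBm : MeasurableSet B := hle _ hB
    have hBpast : ∀ V W : Frame n k, (∀ j : Fin k, (j : ℕ) < t → V.1 j = W.1 j) →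
        (V ∈ B ↔ W ∈ B) := by
      obtain ⟨S, -, rfl⟩ := hB
      intro V W hVW
      have : (fun j : {j : Fin k // (j : ℕ) < t} => V.1 j.1) =
          fun j => W.1 j.1 :=
        funext fun j => hVW j j.2
      simp only [Set.mem_preimage, this]
    let T : Set (O n × fixer V₀ t) :=
      (fun z : O n × fixer V₀ t => rotate (z.1 * z.2.1) V₀) ⁻¹' (A ∩ B)
    have hT : MeasurableSet T := (continuous_rotate_mul V₀ t).measurable (hA.inter hBm)
    have hrot := (continuous_rotate V₀).measurable
    have hκ : Measurable fun V => haarFrameGiven t V A :=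
      (measurable_haarFrameGiven h t hA).mono hle le_rfl
    calc ∫⁻ V in B, haarFrameGiven t V A ∂haarFrame h
        = ∫⁻ P, B.indicator (fun V => haarFrameGiven t V A) (rotate P V₀) ∂haarProb (O n) := by
          rw [← lintegral_indicator hBm, haarFrame, lintegral_map (hκ.indicator hBm) hrot]
      _ = ∫⁻ P, haarProb (fixer V₀ t) (Prod.mk P ⁻¹' T) ∂haarProb (O n) := by
          refine lintegral_congr fun P => ?_
          -- `B` only sees the first `t` vectors, which `Q` does not move.
          have hiff : ∀ Q : fixer V₀ t, rotate (P * Q.1) V₀ ∈ B ↔ rotate P V₀ ∈ B := fun Q =>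
            hBpast _ _ fun j hj => rotate_fixer_apply P Q hj
          by_cases hP : rotate P V₀ ∈ B
          · rw [Set.indicator_of_mem hP, haarFrameGiven_rotate_apply t P V₀ hA]
            congr 1
            ext Q
            simp [T, hiff, hP]
          · rw [Set.indicator_of_notMem hP]
            have : Prod.mk P ⁻¹' T = ∅ := by
              ext Q
              simp [T, hiff, hP]
            rw [this, measure_empty]
      _ = ∫⁻ Q, haarProb (O n) ((fun P => (P, Q)) ⁻¹' T) ∂haarProb (fixer V₀ t) := by
          rw [← Measure.prod_apply hT, Measure.prod_apply_symm hT]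
      _ = ∫⁻ _, haarFrame h (A ∩ B) ∂haarProb (fixer V₀ t) := by
          refine lintegral_congr fun Q => ?_
          rw [haarFrame, Measure.map_apply hrot (hA.inter hBm)]
          change _ = haarProb (O n) _
          -- For fixed `Q`, right invariance makes `P Q` Haar-distributed.
          conv_rhs => rw [← map_mul_right_haarProb (Q : O n)]
          rw [Measure.map_apply (measurable_mul_const _) (hrot (hA.inter hBm))]
          rfl
      _ = haarFrame h (A ∩ B) := by simp
  fiber V := by
    have hm : MeasurableSet {W : Frame n k | ∀ j : Fin k, (j : ℕ) < t → W.1 j = V.1 j} := by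
      simp only [Set.ofPred_forall]
      exact MeasurableSet.iInter fun j => MeasurableSet.iInter fun _ =>
        (measurable_frame_apply j) (measurableSet_singleton _)
    rw [haarFrameGiven, Measure.map_apply _ hm.compl]
    · convert measure_empty (μ := haarProb (fixer V t))
      ext Q
      simp only [Set.mem_preimage, Set.mem_compl_iff, Set.mem_ofPred_eq, Set.mem_empty_iff_false,
        iff_false, not_not]
      exact fun j hj => Q.2 j hj
    · exact measurable_rotate_fixer t V

/-! ### Concentration of the coordinates of a random unit vector -/

/-- Sign symmetry stands in for independence: averaging over the flip of index `l` replaces `exp (c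
l)` by `cosh (c l)`, one index at a time, and `cosh c ≤ exp (c² / 2)`. -/
theorem integral_exp_sum_le_of_flip {Ω ι : Type*} [MeasurableSpace Ω] [TopologicalSpace Ω]
    [CompactSpace Ω] [OpensMeasurableSpace Ω] [Fintype ι] [DecidableEq ι] (μ : Measure Ω)
    [IsProbabilityMeasure μ] (c : ι → Ω → ℝ) (hc : ∀ l, Continuous (c l))
    (s : ℝ) (hs : ∀ ω, ∑ l, c l ω ^ 2 ≤ s)
    (flip : ι → Ω → Ω) (hflip : ∀ l (F : Ω → ℝ), ∫ ω, F (flip l ω) ∂μ = ∫ ω, F ω ∂μ)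
    (hcf : ∀ l m ω, c m (flip l ω) = if m = l then -c m ω else c m ω) :
    ∫ ω, Real.exp (∑ l, c l ω) ∂μ ≤ Real.exp (s / 2) := by
  have hint : ∀ F : Ω → ℝ, Continuous F → Integrable F μ := fun F hF =>
    hF.integrable_of_hasCompactSupport (HasCompactSupport.of_compactSpace F)
  have key : ∀ S : Finset ι, ∫ ω, Real.exp (∑ l, c l ω) ∂μ =
      ∫ ω, (∏ l ∈ S, Real.cosh (c l ω)) * Real.exp (∑ l ∈ Sᶜ, c l ω) ∂μ := by
    intro S
    induction S using Finset.induction_on with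
    | empty => simp
    | insert l S hl ih =>
      have hsplit : ∀ ω, ∑ m ∈ Sᶜ, c m ω = c l ω + ∑ m ∈ (insert l S)ᶜ, c m ω := by
        intro ω
        rw [Finset.compl_insert, Finset.add_sum_erase _ (fun m => c m ω) (by simpa using hl)]
      have hcontP : Continuous fun ω => ∏ m ∈ S, Real.cosh (c m ω) :=
        continuous_finsetProd _ fun m _ => Real.continuous_cosh.comp (hc m)
      have hcontS : Continuous fun ω => ∑ m ∈ (insert l S)ᶜ, c m ω :=
        continuous_finsetSum _ fun m _ => hc m
      have h1 := hflip l fun ω => (∏ m ∈ S, Real.cosh (c m ω)) * Real.exp (∑ m ∈ Sᶜ, c m ω)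
      have h2 : ∀ ω, (∏ m ∈ S, Real.cosh (c m (flip l ω))) *
          Real.exp (∑ m ∈ Sᶜ, c m (flip l ω)) =
          (∏ m ∈ S, Real.cosh (c m ω)) * Real.exp (-c l ω + ∑ m ∈ (insert l S)ᶜ, c m ω) := by
        intro ω
        rw [hsplit]
        congr 1
        · refine Finset.prod_congr rfl fun m hm => ?_
          rw [hcf, if_neg (by rintro rfl; exact hl hm)]
        · rw [hcf, if_pos rfl]
          congr 2
          refine Finset.sum_congr rfl fun m hm => ?_
          rw [hcf, if_neg]
          rintro rfl
          simp at hm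
      simp only [h2] at h1
      rw [ih]
      have h3 : ∀ a b : ℝ, a = b → a = (a + b) / 2 := fun a b h => by rw [h]; ring
      rw [h3 _ _ h1.symm, ← integral_add, ← integral_div]
      · refine integral_congr_ae (Filter.Eventually.of_forall fun ω => ?_)
        simp only
        rw [Finset.prod_insert hl, hsplit, Real.exp_add, Real.exp_add, Real.cosh_eq]
        ring
      · exact hint _ (hcontP.mul (Real.continuous_exp.comp
          (continuous_finsetSum _ fun m _ => hc m)))
      · exact hint _ (hcontP.mul (Real.continuous_exp.comp ((hc l).neg.add hcontS)))
  rw [key Finset.univ]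
  have hle : ∀ ω, (∏ l, Real.cosh (c l ω)) * Real.exp (∑ l ∈ Finset.univᶜ, c l ω) ≤
      Real.exp (s / 2) := by
    intro ω
    rw [Finset.compl_univ, Finset.sum_empty, Real.exp_zero, mul_one]
    calc ∏ l, Real.cosh (c l ω) ≤ ∏ l, Real.exp (c l ω ^ 2 / 2) :=
          Finset.prod_le_prod (fun l _ => (Real.cosh_pos _).le)
            fun l _ => Real.cosh_le_exp_half_sq _
      _ = Real.exp ((∑ l, c l ω ^ 2) / 2) := by rw [← Real.exp_sum, Finset.sum_div]
      _ ≤ _ := Real.exp_le_exp.2 (by linarith [hs ω])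
  calc _ ≤ ∫ _, Real.exp (s / 2) ∂μ := by
        refine integral_mono (hint _ ?_) (integrable_const _) hle
        exact (continuous_finsetProd _ fun m _ => Real.continuous_cosh.comp (hc m)).mul
          (Real.continuous_exp.comp (continuous_finsetSum _ fun m _ => hc m))
    _ = _ := by simp

/-- Reflection in the hyperplane orthogonal to `z`. -/
def hyperplaneReflection {n : ℕ} (z : E n) : O n :=
  Unitary.linearIsometryEquiv.symm (Submodule.reflection (Submodule.span ℝ {z})ᗮ)

theorem hyperplaneReflection_self {n : ℕ} (z : E n) :
    (hyperplaneReflection z : E n →L[ℝ] E n) z = -z :=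
  Submodule.reflection_orthogonalComplement_singleton_eq_neg z

theorem hyperplaneReflection_of_inner_eq_zero {n : ℕ} {z x : E n} (h : inner ℝ z x = 0) :
    (hyperplaneReflection z : E n →L[ℝ] E n) x = x :=
  Submodule.reflection_mem_subspace_eq_self (Submodule.mem_orthogonal_singleton_iff_inner_right.2 h)

theorem inner_hyperplaneReflection_left {n : ℕ} (z x y : E n) :
    inner ℝ x ((hyperplaneReflection z : E n →L[ℝ] E n) y) =
      inner ℝ ((hyperplaneReflection z : E n →L[ℝ] E n) x) y := by
  rw [← Unitary.inner_map_map (hyperplaneReflection z) x]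
  congr 1
  exact Submodule.reflection_reflection _ _

/-- The orthogonal complement of the first `t` vectors of a frame. -/
def restSpace {n k : ℕ} (V : Frame n k) (t : ℕ) : Submodule ℝ (E n) :=
  (Submodule.span ℝ (V.1 '' {j : Fin k | (j : ℕ) < t}))ᗮ

theorem mem_restSpace {n k : ℕ} {V : Frame n k} {t : ℕ} {x : E n} :
    x ∈ restSpace V t ↔ ∀ j : Fin k, (j : ℕ) < t → inner ℝ (V.1 j) x = 0 := by
  constructor
  · intro hx j hj
    exact hx _ (Submodule.subset_span ⟨j, hj, rfl⟩)
  · intro h y hy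
    induction hy using Submodule.span_induction with
    | mem y hy => obtain ⟨j, hj, rfl⟩ := hy; exact h j hj
    | zero => simp
    | add y z _ _ hy hz => rw [inner_add_left, hy, hz, add_zero]
    | smul a y _ hy => rw [inner_smul_left, hy, mul_zero]

theorem le_finrank_restSpace {n k : ℕ} (V : Frame n k) (t : ℕ) :
    n ≤ Module.finrank ℝ (restSpace V t) + t := by
  have h := Submodule.finrank_add_finrank_orthogonal
    (Submodule.span ℝ (V.1 '' {j : Fin k | (j : ℕ) < t}))
  rw [finrank_euclideanSpace_fin] at h
  have h1 : Module.finrank ℝ (Submodule.span ℝ (V.1 '' {j : Fin k | (j : ℕ) < t})) ≤ t := by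
    refine (finrank_span_le_card _).trans ?_
    rw [Set.toFinset_card, ← Nat.card_eq_fintype_card, Nat.card_coe_set_eq]
    refine (Set.ncard_image_le (Set.toFinite _)).trans ?_
    have : (Fin.val '' {j : Fin k | (j : ℕ) < t}) ⊆ (Finset.range t : Set ℕ) := by
      rintro _ ⟨j, hj, rfl⟩
      simpa using hj
    calc _ = (Fin.val '' {j : Fin k | (j : ℕ) < t}).ncard :=
          (Set.ncard_image_of_injective _ Fin.val_injective).symm
      _ ≤ (Finset.range t : Set ℕ).ncard := Set.ncard_le_ncard this (Finset.finite_toSet _)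
      _ = t := by rw [Set.ncard_coe_finset, Finset.card_range]
  unfold restSpace
  omega

theorem hyperplaneReflection_mem_fixer {n k : ℕ} {V : Frame n k} {t : ℕ} {z : E n}
    (hz : z ∈ restSpace V t) : hyperplaneReflection z ∈ fixer V t := fun j hj =>
  hyperplaneReflection_of_inner_eq_zero (by rw [real_inner_comm]; exact mem_restSpace.1 hz j hj)

theorem apply_mem_restSpace {n k : ℕ} {V : Frame n k} {t : ℕ} (Q : fixer V t) {j : Fin k}
    (hj : t ≤ (j : ℕ)) : (Q : O n).1 (V.1 j) ∈ restSpace V t := by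
  refine mem_restSpace.2 fun i hi => ?_
  have h : (Q : O n).1 (V.1 i) = V.1 i := Q.2 i hi
  rw [← h, Unitary.inner_map_map]
  exact V.2.2 (fun hij => by subst hij; omega)

theorem continuous_inner_apply {n k : ℕ} (V : Frame n k) (t : ℕ) (j : Fin k) (x : E n) :
    Continuous fun Q : fixer V t => inner ℝ x ((Q : O n).1 (V.1 j)) :=
  (continuous_const).inner ((ContinuousLinearMap.apply ℝ (E n) (V.1 j)).continuous.comp
    (continuous_subtype_val.comp continuous_subtype_val))

/-- Only the projection `y` of `x` to the complement `W` matters, and invariance allows rotating it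
inside `W` to a vector `u` with equal coordinates in an orthonormal basis. The squares of the
summands of `a⟨u, v⟩` then have the constant sum `a²‖y‖²/d`, and reflections in the basis vectors
flip the summands one by one. -/
theorem integral_exp_inner_le {n k : ℕ} (V : Frame n k) {t : ℕ} (ht : t < n) {j : Fin k}
    (hj : t ≤ (j : ℕ)) {x : E n} (hx : ‖x‖ ≤ 1) (a : ℝ) :
    ∫ Q : fixer V t, Real.exp (a * inner ℝ x ((Q : O n).1 (V.1 j))) ∂haarProb (fixer V t) ≤
      Real.exp (a ^ 2 / (2 * (n - t))) := by
  obtain ⟨W, hW⟩ : ∃ W, W = restSpace V t := ⟨_, rfl⟩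
  have hd : n ≤ Module.finrank ℝ W + t := by
    rw [hW]
    exact le_finrank_restSpace V t
  let d := Module.finrank ℝ W
  have hd0 : (0 : ℝ) < d := by exact_mod_cast (by omega : 0 < d)
  have hdn : (n : ℝ) - t ≤ d := by
    have : (n : ℝ) ≤ d + t := by exact_mod_cast hd
    linarith
  have hnt : (0 : ℝ) < n - t := by
    have : (t : ℝ) < n := by exact_mod_cast ht
    linarith
  let b := stdOrthonormalBasis ℝ W
  let y : E n := W.starProjection x
  have hy : y ∈ W := Submodule.starProjection_apply_mem W x
  have hy1 : ‖y‖ ≤ 1 := (Submodule.norm_starProjection_apply_le W x).trans hx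
  have hinner : ∀ w ∈ W, inner ℝ x w = inner ℝ y w := fun w hw => by
    have := Submodule.starProjection_inner_eq_zero (K := W) x w hw
    rw [inner_sub_left, sub_eq_zero] at this
    exact this
  let r : ℝ := ‖y‖ / √d
  let u' : W := ∑ l, r • b l
  let u : E n := u'
  have hu : ‖y‖ = ‖u‖ := by
    have h1 : ‖u'‖ ^ 2 = ‖y‖ ^ 2 := by
      rw [← b.sum_sq_norm_inner_right u']
      have : ∀ l, inner ℝ (b l) u' = r := fun l =>
        b.orthonormal.inner_right_fintype (fun _ => r) l
      simp only [this]
      rw [Finset.sum_const, Finset.card_univ, Fintype.card_fin, nsmul_eq_mul, Real.norm_eq_abs,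
        sq_abs, div_pow, Real.sq_sqrt hd0.le]
      change (d : ℝ) * _ = _
      field_simp
    have h2 : ‖u'‖ = ‖y‖ := (sq_eq_sq₀ (norm_nonneg _) (norm_nonneg _)).1 h1
    exact h2.symm
  have huW : u ∈ W := u'.2
  -- As `‖y‖ = ‖u‖`, this reflection swaps `y` and `u`; it fixes the first `t` vectors because `y -
  -- u` lies in `W`.
  let R := hyperplaneReflection (y - u)
  have hR : R ∈ fixer V t := hyperplaneReflection_mem_fixer (hW ▸ W.sub_mem hy huW)
  let v : fixer V t → E n := fun Q => (Q : O n).1 (V.1 j)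
  have hv : ∀ Q, v Q ∈ W := fun Q => hW ▸ apply_mem_restSpace Q hj
  have hv1 : ∀ Q, ‖v Q‖ = 1 := fun Q => by
    rw [Unitary.norm_map]; exact V.2.1 j
  let c : Fin d → fixer V t → ℝ := fun l Q => a * r * inner ℝ (b l : E n) (v Q)
  have h1 : ∫ Q, Real.exp (a * inner ℝ x (v Q)) ∂haarProb (fixer V t) =
      ∫ Q, Real.exp (∑ l, c l Q) ∂haarProb (fixer V t) := by
    rw [← integral_mul_left_eq_self (μ := haarProb (fixer V t)) _ ⟨R, hR⟩]
    refine integral_congr_ae (Filter.Eventually.of_forall fun Q => ?_)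
    have hvR : v (⟨R, hR⟩ * Q) = R.1 (v Q) := rfl
    simp only
    rw [hinner _ (hv _), hvR, inner_hyperplaneReflection_left]
    have hRu : R.1 y = u := Submodule.reflection_sub hu
    change Real.exp (a * inner ℝ (R.1 y) (v Q)) = _
    rw [hRu]
    simp only [u, u', Submodule.coe_smul, Submodule.coe_sum, inner_smul_left, sum_inner, c,
      ← Finset.mul_sum, conj_trivial, mul_assoc]
    rfl
  have h2 : ∫ Q, Real.exp (∑ l, c l Q) ∂haarProb (fixer V t) ≤
      Real.exp ((a * r) ^ 2 / 2) := by
    refine integral_exp_sum_le_of_flip (haarProb (fixer V t)) c ?_ _ ?_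
      (fun l Q => ⟨hyperplaneReflection (b l : E n),
        hyperplaneReflection_mem_fixer (hW ▸ (b l).2)⟩ * Q) ?_ ?_
    · exact fun l => continuous_const.mul (continuous_inner_apply V t j _)
    · intro Q
      have h := b.sum_sq_norm_inner_right ⟨v Q, hv Q⟩
      have hn : ‖(⟨v Q, hv Q⟩ : W)‖ = 1 := hv1 Q
      simp only [hn, Submodule.coe_inner, Real.norm_eq_abs, sq_abs] at h
      simp only [c, mul_pow, ← Finset.mul_sum]
      rw [h]
      simp
    · intro l F
      exact integral_mul_left_eq_self F _
    · intro l m Q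
      change a * r * inner ℝ (b m : E n) ((hyperplaneReflection (b l : E n)).1 (v Q)) = _
      rw [inner_hyperplaneReflection_left]
      split_ifs with hml
      · subst hml
        have h := hyperplaneReflection_self (b m : E n)
        rw [show (hyperplaneReflection (b m : E n)).1 (b m) = -(b m : E n) from h,
          inner_neg_left, mul_neg]
      · have h : inner ℝ (b l : E n) (b m : E n) = 0 := b.orthonormal.2 (Ne.symm hml)
        rw [hyperplaneReflection_of_inner_eq_zero h]
  refine h1.le.trans (h2.trans (Real.exp_le_exp.2 ?_))
  have h3 : (a * r) ^ 2 = a ^ 2 * ‖y‖ ^ 2 / d := by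
    rw [mul_pow, div_pow, Real.sq_sqrt hd0.le]; ring
  have h4 : ‖y‖ ^ 2 ≤ 1 := pow_le_one₀ (norm_nonneg _) hy1
  calc (a * r) ^ 2 / 2 ≤ a ^ 2 / d / 2 := by
        rw [h3]
        gcongr
        exact mul_le_of_le_one_right (sq_nonneg a) h4
    _ = a ^ 2 / (2 * d) := by rw [div_div, mul_comm]
    _ ≤ _ := by gcongr

theorem haarProb_inner_ge_le {n k : ℕ} (V : Frame n k) {t : ℕ} (ht : t < n) {j : Fin k}
    (hj : t ≤ (j : ℕ)) {x : E n} (hx : ‖x‖ ≤ 1) {τ : ℝ} (hτ : 0 ≤ τ) :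
    (haarProb (fixer V t)).real {Q : fixer V t | τ ≤ inner ℝ x ((Q : O n).1 (V.1 j))} ≤
      Real.exp (-((n - t) * τ ^ 2 / 2)) := by
  have hnt : (0 : ℝ) < n - t := by
    have : (t : ℝ) < n := by exact_mod_cast ht
    linarith
  have hcont := continuous_inner_apply V t j x
  -- Chernoff bound; the parameter `a = (n - t) τ` minimizes `-aτ + a²/(2(n - t))`.
  have h := ProbabilityTheory.measure_ge_le_exp_mul_mgf (μ := haarProb (fixer V t))
    (X := fun Q : fixer V t => inner ℝ x ((Q : O n).1 (V.1 j))) (t := (n - t) * τ) τ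
    (by positivity)
    ((Real.continuous_exp.comp (continuous_const.mul hcont)).integrable_of_hasCompactSupport
      (HasCompactSupport.of_compactSpace _))
  refine h.trans ?_
  calc _ ≤ Real.exp (-((n - t) * τ) * τ) * Real.exp (((n - t) * τ) ^ 2 / (2 * (n - t))) :=
        mul_le_mul_of_nonneg_left (integral_exp_inner_le V ht hj hx _) (Real.exp_pos _).le
    _ = _ := by
      rw [← Real.exp_add]
      congr 1
      field_simp
      ring

theorem haarFrameGiven_abs_inner_ge_le {n k : ℕ} (V : Frame n k) {t : ℕ} (ht : t < n) {j : Fin k}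
    (hj : t ≤ (j : ℕ)) {x : E n} (hx : ‖x‖ ≤ 1) {τ : ℝ} (hτ : 0 ≤ τ) :
    (haarFrameGiven t V).real {U | τ ≤ |inner ℝ (U.1 j) x|} ≤
      2 * Real.exp (-((n - t) * τ ^ 2 / 2)) := by
  have hm : MeasurableSet {U : Frame n k | τ ≤ |inner ℝ (U.1 j) x|} := by
    refine measurableSet_le measurable_const ?_
    exact continuous_abs.measurable.comp ((measurable_frame_apply j).inner measurable_const)
  rw [haarFrameGiven, map_measureReal_apply (measurable_rotate_fixer t V) hm]
  have hsub : (fun Q : fixer V t => rotate (Q : O n) V) ⁻¹'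
      {U : Frame n k | τ ≤ |inner ℝ (U.1 j) x|} ⊆
      {Q : fixer V t | τ ≤ inner ℝ x ((Q : O n).1 (V.1 j))} ∪
      {Q : fixer V t | τ ≤ inner ℝ (-x) ((Q : O n).1 (V.1 j))} := by
    intro Q hQ
    have hQ' : τ ≤ |inner ℝ ((Q : O n).1 (V.1 j)) x| := hQ
    rw [real_inner_comm] at hQ'
    rcases le_abs.1 hQ' with h | h
    · exact Or.inl h
    · exact Or.inr (by simpa [inner_neg_left] using h)
  calc _ ≤ (haarProb (fixer V t)).real _ := measureReal_mono hsub
    _ ≤ _ := measureReal_union_le _ _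
    _ ≤ _ := by
      rw [two_mul]
      exact add_le_add (haarProb_inner_ge_le V ht hj hx hτ)
        (haarProb_inner_ge_le V ht hj (by rwa [norm_neg]) hτ)

/-! ### Smoothing -/

section Smoothing

variable {n : ℕ} {G : Type*} [NormedAddCommGroup G] [NormedSpace ℝ G]

/-- The mean of a vector-valued function over a ball. -/
def ballMean (η : ℝ) (F : E n → G) : E n → G :=
  fun x => ⨍ y in Metric.closedBall x η, F y

theorem ballSmooth_eq_ballMean (η : ℝ) (F : E n → ℝ) : ballSmooth η F = ballMean η F := rfl

/-- The volume of a ball of radius `η`. -/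
def ballVol (n : ℕ) (η : ℝ) : ℝ := volume.real (Metric.closedBall (0 : E n) η)

theorem volume_real_closedBall (x : E n) (η : ℝ) :
    volume.real (Metric.closedBall x η) = ballVol n η := by
  rw [ballVol, measureReal_def, measureReal_def, Measure.addHaar_closedBall_center]

theorem ballVol_pos {η : ℝ} (hη : 0 < η) : 0 < ballVol n η :=
  ENNReal.toReal_pos (Metric.measure_closedBall_pos volume _ hη).ne' measure_closedBall_lt_top.ne

theorem ballVol_eq {η : ℝ} (hη : 0 ≤ η) :
    ballVol n η = η ^ n * volume.real (Metric.ball (0 : E n) 1) := by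
  rw [ballVol, measureReal_def, Measure.addHaar_closedBall _ _ hη, ENNReal.toReal_mul,
    ENNReal.toReal_ofReal (by positivity), finrank_euclideanSpace_fin, measureReal_def]

/-- Moves the dependence on `x` from the domain into the integrand, ready for differentiation. -/
theorem ballMean_eq (η : ℝ) (F : E n → G) (x : E n) :
    ballMean η F x = (ballVol n η)⁻¹ • ∫ y in Metric.closedBall 0 η, F (y + x) := by
  rw [ballMean, setAverage_eq, volume_real_closedBall]
  congr 1
  rw [← (measurePreserving_add_right volume x).setIntegral_preimage_emb
    (measurableEmbedding_addRight x) F]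
  congr 2
  ext y
  simp

theorem LipschitzWith.ballMean {K : NNReal} {F : E n → G} (hF : LipschitzWith K F) {η : ℝ}
    (hη : 0 < η) : LipschitzWith K (ballMean η F) := by
  refine LipschitzWith.of_dist_le_mul fun x x' => ?_
  have hint : ∀ z : E n, IntegrableOn (fun y => F (y + z)) (Metric.closedBall 0 η) := fun z =>
    (hF.continuous.comp (continuous_id.add continuous_const)).continuousOn.integrableOn_compact
      (isCompact_closedBall _ _)
  rw [dist_eq_norm, ballMean_eq, ballMean_eq, ← smul_sub, ← integral_sub (hint x) (hint x'),
    norm_smul, norm_inv, Real.norm_of_nonneg (ballVol_pos hη).le,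
    inv_mul_le_iff₀ (ballVol_pos hη)]
  have := norm_setIntegral_le_of_norm_le_const (μ := volume) (s := Metric.closedBall (0 : E n) η)
    (f := fun y => F (y + x) - F (y + x')) (C := K * dist x x') measure_closedBall_lt_top
    fun y _ => by
      rw [← dist_eq_norm]
      simpa using hF.dist_le_mul (y + x) (y + x')
  rwa [mul_comm] at this

/-- By Rademacher `F` is differentiable almost everywhere, and its Lipschitz constant dominates the
difference quotients under the integral. -/
theorem hasFDerivAt_ballMean [FiniteDimensional ℝ G] {K : NNReal} {F : E n → G}
    (hF : LipschitzWith K F) (η : ℝ) (x : E n) :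
    HasFDerivAt (ballMean η F) (ballMean η (fderiv ℝ F) x) x := by
  have hball : ballMean η F =
      fun x => (ballVol n η)⁻¹ • ∫ y in Metric.closedBall 0 η, F (y + x) :=
    funext (ballMean_eq η F)
  rw [hball, ballMean_eq]
  refine HasFDerivAt.const_smul ?_ _
  have hfin : IsFiniteMeasure (volume.restrict (Metric.closedBall (0 : E n) η)) :=
    ⟨by simpa using measure_closedBall_lt_top⟩
  have hcont : ∀ z : E n, Continuous fun y => F (y + z) := fun z =>
    hF.continuous.comp (continuous_id.add continuous_const)
  have : CompleteSpace G := FiniteDimensional.complete ℝ G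
  refine (hasFDerivAt_integral_of_dominated_loc_of_lip (s := Set.univ) (bound := fun _ => (K : ℝ))
    Filter.univ_mem (Filter.Eventually.of_forall fun z => (hcont z).aestronglyMeasurable) ?_ ?_
    ?_ (integrable_const _) ?_).2
  · exact (hcont x).continuousOn.integrableOn_compact (isCompact_closedBall _ _)
  · have : ProperSpace (E n →L[ℝ] G) := FiniteDimensional.proper ℝ _
    exact ((measurable_fderiv ℝ F).stronglyMeasurable.comp_measurable
      (measurable_add_const x)).aestronglyMeasurable
  · refine Filter.Eventually.of_forall fun y => ?_
    have hK : Real.nnabs (K : ℝ) = K := by simp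
    rw [hK, lipschitzOnWith_univ]
    exact LipschitzWith.of_dist_le_mul fun z z' => by
      simpa using hF.dist_le_mul (y + z) (y + z')
  · have h := (measurePreserving_add_right volume x).quasiMeasurePreserving.ae
      (hF.ae_differentiableAt (μ := volume))
    filter_upwards [ae_restrict_of_ae h] with y hy
    exact hasFDerivAt_comp_add_left y |>.2 hy.hasFDerivAt

/-- For close centres, the ball about `x` of radius `η - dist x x'` lies in both balls, and
Bernoulli's inequality bounds the rest. The factor `n + 1` instead of `n` keeps the case of distant
centres true for `n = 0`. -/
theorem volume_closedBall_diff_le {η : ℝ} (hη : 0 < η) (x x' : E n) :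
    volume.real (Metric.closedBall x η \ Metric.closedBall x' η) ≤
      ballVol n η * ((n + 1) / η * dist x x') := by
  have hfin : volume (Metric.closedBall x η) ≠ ⊤ := measure_closedBall_lt_top.ne
  have hv := ballVol_pos (n := n) hη
  rcases le_or_gt (dist x x') η with h | h
  · have hsub : Metric.closedBall x η \ Metric.closedBall x' η ⊆
        Metric.closedBall x η \ Metric.closedBall x (η - dist x x') := by
      intro y hy
      refine ⟨hy.1, fun hy' => hy.2 ?_⟩
      rw [Metric.mem_closedBall] at hy' ⊢
      linarith [dist_triangle y x x']
    have hle : Metric.closedBall x (η - dist x x') ⊆ Metric.closedBall x η :=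
      Metric.closedBall_subset_closedBall (by linarith [dist_nonneg (x := x) (y := x')])
    have h1 : volume.real (Metric.closedBall x η \ Metric.closedBall x (η - dist x x')) =
        ballVol n η - ballVol n (η - dist x x') := by
      rw [measureReal_sdiff hle measurableSet_closedBall, volume_real_closedBall,
        volume_real_closedBall]
    have h2 : ballVol n η * (1 - n * (dist x x' / η)) ≤ ballVol n (η - dist x x') := by
      rw [ballVol_eq hη.le, ballVol_eq (by linarith)]
      have h3 : η - dist x x' = η * (1 + -(dist x x' / η)) := by field_simp; ring
      have h4 := one_add_mul_le_pow (a := -(dist x x' / η))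
        (by have := (div_le_one hη).2 h; linarith) n
      rw [h3, mul_pow]
      calc _ = η ^ n * (1 + n * -(dist x x' / η)) * volume.real (Metric.ball (0 : E n) 1) := by
            ring
        _ ≤ _ := by gcongr
    calc _ ≤ volume.real (Metric.closedBall x η \ Metric.closedBall x (η - dist x x')) :=
          measureReal_mono hsub (measure_ne_top_of_subset Set.sdiff_subset hfin)
      _ ≤ ballVol n η * (n * (dist x x' / η)) := by rw [h1]; linarith
      _ ≤ _ := by
        refine mul_le_mul_of_nonneg_left ?_ hv.le
        rw [div_mul_eq_mul_div, mul_div_assoc]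
        exact mul_le_mul_of_nonneg_right (by linarith) (by positivity)
  · calc _ ≤ volume.real (Metric.closedBall x η) := measureReal_mono Set.sdiff_subset hfin
      _ = ballVol n η * 1 := by rw [volume_real_closedBall, mul_one]
      _ ≤ _ := by
        refine mul_le_mul_of_nonneg_left ?_ hv.le
        rw [div_mul_eq_mul_div, one_le_div hη]
        nlinarith [dist_nonneg (x := x) (y := x'), (Nat.cast_nonneg n : (0 : ℝ) ≤ n)]

theorem exists_lipschitzWith_ballMean_of_bounded {F : E n → G} (hm : AEStronglyMeasurable F volume)
    {M : ℝ} (hM : ∀ x, ‖F x‖ ≤ M) {η : ℝ} (hη : 0 < η) :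
    ∃ K, LipschitzWith K (ballMean η F) := by
  have hv := ballVol_pos (n := n) hη
  have hM0 : 0 ≤ M := (norm_nonneg _).trans (hM 0)
  refine ⟨Real.toNNReal (2 * M * ((n + 1) / η)), LipschitzWith.of_dist_le_mul fun x x' => ?_⟩
  rw [Real.coe_toNNReal _ (by positivity)]
  have hint : ∀ z : E n, IntegrableOn F (Metric.closedBall z η) := fun z =>
    Measure.integrableOn_of_bounded measure_closedBall_lt_top.ne hm
      (Filter.Eventually.of_forall hM)
  have hdiff : ∀ z z' : E n,
      ‖∫ y in Metric.closedBall z η \ Metric.closedBall z' η, F y‖ ≤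
        M * (ballVol n η * ((n + 1) / η * dist z z')) := fun z z' =>
    (norm_setIntegral_le_of_norm_le_const
      ((measure_mono Set.sdiff_subset).trans_lt measure_closedBall_lt_top) fun y _ => hM y).trans
      (mul_le_mul_of_nonneg_left (volume_closedBall_diff_le hη z z') hM0)
  have h1 := integral_inter_add_sdiff (μ := volume) (f := F) (s := Metric.closedBall x η)
    (t := Metric.closedBall x' η) measurableSet_closedBall (hint x)
  have h2 := integral_inter_add_sdiff (μ := volume) (f := F) (s := Metric.closedBall x' η)
    (t := Metric.closedBall x η) measurableSet_closedBall (hint x')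
  rw [Set.inter_comm] at h2
  rw [dist_eq_norm, ballMean, ballMean, setAverage_eq, setAverage_eq, volume_real_closedBall,
    volume_real_closedBall, ← smul_sub, norm_smul, norm_inv, Real.norm_of_nonneg hv.le,
    inv_mul_le_iff₀ hv, ← h1, ← h2, add_sub_add_left_eq_sub]
  have h3 := hdiff x x'
  have h4 := hdiff x' x
  rw [dist_comm x' x] at h4
  calc _ ≤ _ := norm_sub_le _ _
    _ ≤ _ := add_le_add h3 h4
    _ = _ := by rw [dist_eq_norm]; ring

end Smoothing

/-- `F` is `m` times differentiable, and `F` and its derivatives up to order `m` are Lipschitz. -/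
def LipschitzDerivs {n : ℕ} : ℕ → (G : Type) → [NormedAddCommGroup G] → [NormedSpace ℝ G] →
    (E n → G) → Prop
  | 0, _, _, _, F => ∃ K, LipschitzWith K F
  | m + 1, G, _, _, F => (∃ K, LipschitzWith K F) ∧ Differentiable ℝ F ∧
      LipschitzDerivs m (E n →L[ℝ] G) (fderiv ℝ F)

theorem LipschitzDerivs.exists_lipschitzWith {n m : ℕ} {G : Type} [NormedAddCommGroup G]
    [NormedSpace ℝ G] {F : E n → G} (hF : LipschitzDerivs m G F) : ∃ K, LipschitzWith K F := by
  cases m with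
  | zero => exact hF
  | succ m => exact hF.1

theorem LipschitzDerivs.contDiff {n m : ℕ} {G : Type} [NormedAddCommGroup G]
    [NormedSpace ℝ G] {F : E n → G} (hF : LipschitzDerivs m G F) : ContDiff ℝ m F := by
  induction m generalizing G with
  | zero =>
    obtain ⟨K, hK⟩ := hF
    exact contDiff_zero.2 hK.continuous
  | succ m ih =>
    push_cast
    exact contDiff_succ_iff_fderiv.2 ⟨hF.2.1, by simp, ih hF.2.2⟩

/-- Averaging commutes with the derivative, which gives the recursion. The gain occurs at `m = 0`:
the a.e. derivative is merely bounded and measurable, but its average is Lipschitz. -/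
theorem LipschitzDerivs.ballMean {n m : ℕ} {G : Type} [NormedAddCommGroup G]
    [NormedSpace ℝ G] [FiniteDimensional ℝ G] {F : E n → G} (hF : LipschitzDerivs m G F) {η : ℝ}
    (hη : 0 < η) : LipschitzDerivs (m + 1) G (ballMean η F) := by
  obtain ⟨K, hK⟩ := hF.exists_lipschitzWith
  have hd : fderiv ℝ (HiddenOpt.ballMean η F) = HiddenOpt.ballMean η (fderiv ℝ F) :=
    funext fun x => (hasFDerivAt_ballMean hK η x).fderiv
  refine ⟨⟨K, LipschitzWith.ballMean hK hη⟩,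
    fun x => (hasFDerivAt_ballMean hK η x).differentiableAt, ?_⟩
  rw [hd]
  cases m with
  | zero =>
    have : CompleteSpace G := FiniteDimensional.complete ℝ G
    have : ProperSpace (E n →L[ℝ] G) := FiniteDimensional.proper ℝ _
    exact exists_lipschitzWith_ballMean_of_bounded
      (measurable_fderiv ℝ F).stronglyMeasurable.aestronglyMeasurable
      (fun x => norm_fderiv_le_of_lipschitz ℝ hK) hη
  | succ m => exact LipschitzDerivs.ballMean hF.2.2 hη
termination_by m

theorem lipschitzDerivs_smooth {n : ℕ} {b : ℝ} (hb : 0 < b) {F : E n → ℝ} {K : NNReal}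
    (hF : LipschitzWith K F) (p : ℕ) : LipschitzDerivs p ℝ (smooth b p F) := by
  induction p with
  | zero => exact ⟨K, hF⟩
  | succ p ih => exact ih.ballMean (by positivity)

theorem continuous_smooth {n : ℕ} {b : ℝ} (hb : 0 < b) {F : E n → ℝ} {K : NNReal}
    (hF : LipschitzWith K F) (p : ℕ) : Continuous (smooth b p F) :=
  (lipschitzDerivs_smooth hb hF p).contDiff.continuous

/-- After `p` smoothings a radius `b / 2 ^ p` is left; the next one uses up half of it. -/
theorem smooth_congr {n : ℕ} {b : ℝ} (hb : 0 < b) {F F' : E n → ℝ} {x : E n}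
    (h : ∀ y ∈ Metric.ball x b, F y = F' y) (p : ℕ) :
    ∀ y ∈ Metric.ball x (b / 2 ^ p), smooth b p F y = smooth b p F' y := by
  induction p with
  | zero => simpa [smooth] using h
  | succ p ih =>
    intro y hy
    refine setAverage_congr_fun measurableSet_closedBall (Filter.Eventually.of_forall fun z hz => ?_)
    refine ih z ?_
    rw [Metric.mem_ball] at hy ⊢
    rw [Metric.mem_closedBall] at hz
    have : b / 2 ^ p = b / 2 ^ (p + 1) + b / 2 ^ (p + 1) := by field_simp; ring
    linarith [dist_triangle z y x]

theorem ballSmooth_le {n : ℕ} {η : ℝ} {F F' : E n → ℝ} (hF : Continuous F)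
    (hF' : Continuous F') {x : E n} (h : ∀ y ∈ Metric.closedBall x η, F y ≤ F' y) :
    ballSmooth η F x ≤ ballSmooth η F' x := by
  have hint : ∀ F : E n → ℝ, Continuous F → IntegrableOn F (Metric.closedBall x η) :=
    fun F hF => hF.continuousOn.integrableOn_compact (isCompact_closedBall _ _)
  rw [ballSmooth, ballSmooth, setAverage_eq, setAverage_eq]
  exact mul_le_mul_of_nonneg_left
    (setIntegral_mono_on (hint F hF) (hint F' hF') measurableSet_closedBall h)
    (inv_nonneg.2 measureReal_nonneg)

theorem ballSmooth_const {n : ℕ} {η : ℝ} (hη : 0 < η) (c : ℝ) (x : E n) :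
    ballSmooth η (fun _ => c) x = c :=
  setAverage_const (Metric.measure_closedBall_pos volume _ hη).ne' measure_closedBall_lt_top.ne c

theorem smooth_le_of_forall_mem_ball {n : ℕ} {b : ℝ} (hb : 0 < b) {F : E n → ℝ} {K : NNReal}
    (hF : LipschitzWith K F) {x : E n} {c : ℝ} (h : ∀ y ∈ Metric.ball x b, F y ≤ c) (p : ℕ) :
    ∀ y ∈ Metric.ball x (b / 2 ^ p), smooth b p F y ≤ c := by
  induction p with
  | zero => simpa [smooth] using h
  | succ p ih =>
    intro y hy
    rw [← ballSmooth_const (η := b / 2 ^ (p + 1)) (by positivity) c y]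
    refine ballSmooth_le (continuous_smooth hb hF p) continuous_const
      fun z hz => ih z ?_
    rw [Metric.mem_ball] at hy ⊢
    rw [Metric.mem_closedBall] at hz
    have : b / 2 ^ p = b / 2 ^ (p + 1) + b / 2 ^ (p + 1) := by field_simp; ring
    linarith [dist_triangle z y x]

theorem ballSmooth_inner {n : ℕ} {η : ℝ} (hη : 0 < η) (v x : E n) :
    ballSmooth η (fun y => inner ℝ v y) x = inner ℝ v x := by
  have hc : Continuous fun y : E n => inner ℝ v y := continuous_const.inner continuous_id
  have hint : IntegrableOn (fun y : E n => inner ℝ v y) (Metric.closedBall 0 η) :=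
    hc.continuousOn.integrableOn_compact (isCompact_closedBall _ _)
  have hfin : IsFiniteMeasure (volume.restrict (Metric.closedBall (0 : E n) η)) :=
    ⟨by simpa using measure_closedBall_lt_top⟩
  have h0 : ∫ y in Metric.closedBall (0 : E n) η, inner ℝ v y = 0 := by
    have h := (Measure.measurePreserving_neg (volume : Measure (E n))).setIntegral_preimage_emb
      (MeasurableEquiv.neg (E n)).measurableEmbedding (fun y => inner ℝ v y)
      (Metric.closedBall (0 : E n) η)
    have hs : (Neg.neg ⁻¹' Metric.closedBall (0 : E n) η) = Metric.closedBall 0 η := by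
      ext y; simp
    rw [hs] at h
    simp only [inner_neg_right, integral_neg] at h
    linarith
  rw [ballSmooth_eq_ballMean, ballMean_eq]
  simp only [inner_add_right]
  rw [integral_add hint (integrable_const _), h0, zero_add, setIntegral_const, smul_eq_mul,
    smul_eq_mul]
  change _ * (ballVol n η * _) = _
  rw [inv_mul_cancel_left₀ (ballVol_pos hη).ne']

/-- Ball averages fix linear functions and are monotone. -/
theorem inner_le_smooth {n : ℕ} {b : ℝ} (hb : 0 < b) {F : E n → ℝ} {K : NNReal}
    (hF : LipschitzWith K F) {v : E n} (h : ∀ y, inner ℝ v y ≤ F y) (p : ℕ) :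
    ∀ y, inner ℝ v y ≤ smooth b p F y := by
  induction p with
  | zero => exact h
  | succ p ih =>
    intro y
    rw [← ballSmooth_inner (η := b / 2 ^ (p + 1)) (by positivity) v y]
    exact ballSmooth_le (continuous_const.inner continuous_id)
      (continuous_smooth hb hF p) fun z _ => ih z

/-! ### The parameters -/

theorem gam_nonneg (n : ℕ) : 0 ≤ gam n := by unfold gam; positivity

theorem gam_pos {n : ℕ} (h : 1 ≤ kk n) : 0 < gam n := by
  refine (gam_nonneg n).lt_of_ne fun h0 => ?_
  -- If `γ = 0`, the convention `0.1 / 0 = 0` would give `k = 0`.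
  rw [kk, ← h0, div_zero, Real.zero_rpow (by norm_num), Nat.floor_zero] at h
  omega

theorem gam_sq (n : ℕ) : gam n ^ 2 = 1600 * (Real.log n / n) := by
  rw [gam, mul_pow, Real.sq_sqrt (div_nonneg (Real.log_natCast_nonneg n) n.cast_nonneg)]
  norm_num

theorem kk_pow_mul_gam_sq_le {n : ℕ} (h : 1 ≤ kk n) : (kk n : ℝ) ^ 3 * gam n ^ 2 ≤ 0.01 := by
  have hg := gam_pos h
  have hq : (0 : ℝ) ≤ 0.1 / gam n := by positivity
  have h1 : (kk n : ℝ) ≤ (0.1 / gam n) ^ (2 / 3 : ℝ) := Nat.floor_le (by positivity)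
  have h2 : (kk n : ℝ) ^ 3 ≤ (0.1 / gam n) ^ 2 := by
    calc (kk n : ℝ) ^ 3 ≤ ((0.1 / gam n) ^ (2 / 3 : ℝ)) ^ 3 := by gcongr
      _ = (0.1 / gam n) ^ 2 := by
        rw [← Real.rpow_natCast, ← Real.rpow_natCast (0.1 / gam n), ← Real.rpow_mul hq]
        norm_num
  calc _ ≤ (0.1 / gam n) ^ 2 * gam n ^ 2 := by gcongr
    _ = 0.01 := by rw [← mul_pow, div_mul_cancel₀ _ hg.ne']; norm_num

theorem pos_of_one_le_kk {n : ℕ} (h : 1 ≤ kk n) : (0 : ℝ) < n := by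
  have : 0 < n := by have := kk_le n; omega
  exact_mod_cast this

/-- `k ≥ 1` forces `γ² ≤ 0.01`, so `n ≥ 160000 ln n ≥ 80000 > 3 ^ 8`. The constant 8 serves to make
`β ≤ γ/8`. -/
theorem eight_le_log {n : ℕ} (h : 1 ≤ kk n) : 8 ≤ Real.log n := by
  have hn := pos_of_one_le_kk h
  have hk : (1 : ℝ) ≤ kk n := by exact_mod_cast h
  have h1 : gam n ^ 2 ≤ 0.01 := by
    refine le_trans ?_ (kk_pow_mul_gam_sq_le h)
    exact le_mul_of_one_le_left (sq_nonneg _) (one_le_pow₀ hk)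
  have hpos : 0 < Real.log n := by
    have h2 : 0 < gam n ^ 2 := pow_pos (gam_pos h) 2
    rw [gam_sq] at h2
    refine (Real.log_natCast_nonneg n).lt_of_ne fun h0 => ?_
    rw [← h0] at h2
    simp at h2
  have hn2 : (2 : ℝ) ≤ n := by
    have : n ≠ 1 := by rintro rfl; simp at hpos
    have : 2 ≤ n := by have := kk_le n; omega
    exact_mod_cast this
  have hlog : (1 / 2 : ℝ) ≤ Real.log n := by
    have h3 := Real.log_two_gt_d9
    have h4 := Real.log_le_log (by norm_num) hn2
    linarith
  rw [gam_sq, ← mul_div_assoc, div_le_iff₀ hn] at h1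
  have h5 : (80000 : ℝ) ≤ n := by linarith
  rw [Real.le_log_iff_exp_le hn]
  calc Real.exp 8 = Real.exp 1 ^ 8 := by rw [← Real.exp_nat_mul]; norm_num
    _ ≤ 3 ^ 8 := by
      have := Real.exp_one_lt_d9
      gcongr
      linarith
    _ ≤ n := by linarith

theorem two_mul_kk_le {n : ℕ} (h : 1 ≤ kk n) : 2 * (kk n : ℝ) ≤ n := by
  have hn := pos_of_one_le_kk h
  have hk : (1 : ℝ) ≤ kk n := by exact_mod_cast h
  have h1 := kk_pow_mul_gam_sq_le h
  have hl := eight_le_log h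
  have h2 : (kk n : ℝ) ≤ (kk n : ℝ) ^ 3 := le_self_pow₀ hk (by norm_num)
  have h3 : (kk n : ℝ) * (12800 / n) ≤ 0.01 := by
    refine le_trans (mul_le_mul h2 ?_ (by positivity) (by positivity)) h1
    rw [gam_sq, ← mul_div_assoc]
    exact div_le_div_of_nonneg_right (by linarith) hn.le
  rw [← mul_div_assoc, div_le_iff₀ hn] at h3
  linarith

theorem kk_mul_gam_mul_sqrt_le {n : ℕ} (h : 1 ≤ kk n) : kk n * gam n ≤ 0.1 / √(kk n) := by
  have hk : (0 : ℝ) < kk n := by exact_mod_cast h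
  have hs : 0 < √(kk n : ℝ) := Real.sqrt_pos.2 hk
  have hg := gam_pos h
  rw [le_div_iff₀ hs]
  refine (pow_le_pow_iff_left₀ (by positivity) (by norm_num) two_ne_zero).1 ?_
  rw [mul_pow, Real.sq_sqrt hk.le]
  have := kk_pow_mul_gam_sq_le h
  norm_num at this ⊢
  linarith

theorem bet_pos {n : ℕ} (h : 1 ≤ kk n) : 0 < bet n :=
  div_pos (gam_pos h) (by linarith [eight_le_log h])

theorem bet_le {n : ℕ} (h : 1 ≤ kk n) : bet n ≤ gam n / 8 :=
  div_le_div_of_nonneg_left (gam_nonneg n) (by norm_num) (eight_le_log h)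

theorem one_le_alp (p : ℕ) : 1 ≤ alp p := by
  unfold alp
  linarith [(Nat.cast_nonneg p : (0 : ℝ) ≤ p)]

theorem rho_pos {n : ℕ} (h : 1 ≤ kk n) (p : ℕ) : 0 < rho n p := by
  have := gam_pos h
  have := eight_le_log h
  have := one_le_alp p
  unfold rho
  positivity

theorem rho_mul_alp_mul_log {n : ℕ} (h : 1 ≤ kk n) (p : ℕ) :
    rho n p * (alp p * Real.log n) = gam n / 100 := by
  have h1 := eight_le_log h
  have h2 := one_le_alp p
  unfold rho
  field_simp

theorem rho_mul_log_le {n : ℕ} (h : 1 ≤ kk n) (p : ℕ) : rho n p * Real.log n ≤ gam n / 100 := by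
  rw [← rho_mul_alp_mul_log h p]
  refine mul_le_mul_of_nonneg_left ?_ (rho_pos h p).le
  exact le_mul_of_one_le_left (by linarith [eight_le_log h]) (one_le_alp p)

theorem kk_mul_rpow_le_one {n : ℕ} (h : 1 ≤ kk n) (p : ℕ) :
    (kk n : ℝ) * (n : ℝ) ^ (-alp p) ≤ 1 := by
  have hn := pos_of_one_le_kk h
  have hn1 : (1 : ℝ) ≤ n := by exact_mod_cast hn
  calc (kk n : ℝ) * (n : ℝ) ^ (-alp p) ≤ n * (n : ℝ) ^ (-1 : ℝ) := by
        gcongr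
        · exact kk_le n
        · exact one_le_alp p
    _ = 1 := by rw [Real.rpow_neg_one, mul_inv_cancel₀ hn.ne']

/-- Since `n - t ≥ n/2` and `γ² = 1600 ln n / n`, the exponential is at most `n^{-25}`; the factor
`2k ≤ n` costs one power. -/
theorem two_mul_kk_mul_exp_le {n : ℕ} (h : 1 ≤ kk n) {t : ℕ} (ht : t < kk n) :
    2 * (kk n : ℝ) * Real.exp (-((n - t) * (gam n / 4) ^ 2 / 2)) ≤ (n : ℝ) ^ (-10 : ℤ) := by
  have hn := pos_of_one_le_kk h
  have hl := eight_le_log h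
  have hk := two_mul_kk_le h
  have ht' : (t : ℝ) ≤ kk n := by exact_mod_cast ht.le
  have h1 : 25 * Real.log n ≤ (n - t) * (gam n / 4) ^ 2 / 2 := by
    rw [div_pow, gam_sq]
    calc 25 * Real.log n = (n / 2) * (1600 * (Real.log n / n) / 4 ^ 2) / 2 := by
          field_simp; norm_num
      _ ≤ _ := by gcongr; linarith
  calc _ ≤ Real.exp (Real.log n) * Real.exp (-(25 * Real.log n)) := by
        rw [Real.exp_log hn]
        gcongr
    _ ≤ Real.exp (-10 * Real.log n) := by
        rw [← Real.exp_add]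
        exact Real.exp_le_exp.2 (by linarith)
    _ = (n : ℝ) ^ (-10 : ℤ) := by
        rw [mul_comm, ← Real.rpow_def_of_pos hn, ← Real.rpow_intCast]
        norm_num

/-! ### The soft maximum -/

section Smax

variable {k : ℕ} {r : ℝ} {i : ℕ} {z w : Fin k → ℝ}

theorem exp_le_sum_smaxLE {j : Fin k} (hj : (j : ℕ) < i) :
    Real.exp (z j / r) ≤
      ∑ j ∈ Finset.univ.filter (fun j : Fin k => (j : ℕ) < i), Real.exp (z j / r) :=
  Finset.single_le_sum (f := fun j => Real.exp (z j / r)) (fun _ _ => (Real.exp_pos _).le)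
    (by simpa using hj)

theorem sum_smaxLE_pos (hi : 0 < i) (hk : 0 < k) :
    0 < ∑ j ∈ Finset.univ.filter (fun j : Fin k => (j : ℕ) < i), Real.exp (z j / r) :=
  (Real.exp_pos _).trans_le (exp_le_sum_smaxLE (j := ⟨0, hk⟩) hi)

theorem le_smaxLE (hr : 0 < r) {j : Fin k} (hj : (j : ℕ) < i) : z j ≤ smaxLE r i z := by
  have h := Real.log_le_log (Real.exp_pos _) (exp_le_sum_smaxLE (r := r) (z := z) hj)
  rw [Real.log_exp, div_le_iff₀ hr, mul_comm] at h
  exact h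

theorem smaxLE_le_add (hr : 0 < r) (hi : 0 < i) (hk : 0 < k) {δ : ℝ}
    (h : ∀ j, z j ≤ w j + δ) : smaxLE r i z ≤ smaxLE r i w + δ := by
  have h1 : ∑ j ∈ Finset.univ.filter (fun j : Fin k => (j : ℕ) < i), Real.exp (z j / r) ≤
      (∑ j ∈ Finset.univ.filter (fun j : Fin k => (j : ℕ) < i), Real.exp (w j / r)) *
        Real.exp (δ / r) := by
    rw [Finset.sum_mul]
    refine Finset.sum_le_sum fun j _ => ?_
    rw [← Real.exp_add, ← add_div]
    exact Real.exp_le_exp.2 (div_le_div_of_nonneg_right (h j) hr.le)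
  have h2 := Real.log_le_log (sum_smaxLE_pos hi hk) h1
  rw [Real.log_mul (sum_smaxLE_pos hi hk).ne' (Real.exp_pos _).ne', Real.log_exp] at h2
  calc smaxLE r i z ≤ r * (_ + δ / r) := mul_le_mul_of_nonneg_left h2 hr.le
    _ = _ := by rw [mul_add, mul_div_cancel₀ _ hr.ne']; rfl

theorem smaxLE_le_of_le (hr : 0 < r) (hi : 0 < i) (hk : 0 < k) {c : ℝ} (h : ∀ j, z j ≤ c) :
    smaxLE r i z ≤ c + r * Real.log k := by
  have h1 : ∑ j ∈ Finset.univ.filter (fun j : Fin k => (j : ℕ) < i), Real.exp (z j / r) ≤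
      k * Real.exp (c / r) := by
    calc _ ≤ ∑ _j ∈ Finset.univ.filter (fun j : Fin k => (j : ℕ) < i), Real.exp (c / r) :=
          Finset.sum_le_sum fun j _ =>
            Real.exp_le_exp.2 (div_le_div_of_nonneg_right (h j) hr.le)
      _ ≤ _ := by
        rw [Finset.sum_const, nsmul_eq_mul]
        gcongr
        simpa using Finset.card_filter_le Finset.univ (fun j : Fin k => (j : ℕ) < i)
  have h2 := Real.log_le_log (sum_smaxLE_pos hi hk) h1
  rw [Real.log_mul (by positivity) (Real.exp_pos _).ne', Real.log_exp] at h2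
  calc smaxLE r i z ≤ r * (Real.log k + c / r) := mul_le_mul_of_nonneg_left h2 hr.le
    _ = _ := by rw [mul_add, mul_div_cancel₀ _ hr.ne']; ring

/-- The new term multiplies the sum by at most `1 + θ`, and `log (1 + θ) ≤ θ`. -/
theorem smaxLE_succ_le (hr : 0 < r) {j m : Fin k} (hj : (j : ℕ) < m) {θ : ℝ}
    (h : Real.exp (z m / r) ≤ θ * Real.exp (z j / r)) :
    smaxLE r (m + 1) z ≤ smaxLE r m z + r * θ := by
  have hθ : 0 < θ := by
    by_contra hθ
    have := mul_nonpos_of_nonpos_of_nonneg (not_lt.1 hθ) (Real.exp_pos (z j / r)).le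
    linarith [Real.exp_pos (z m / r)]
  have hk : 0 < k := by have := m.2; omega
  have hS := sum_smaxLE_pos (r := r) (z := z) (i := m) (by omega) hk
  have hfilter : Finset.univ.filter (fun j : Fin k => (j : ℕ) < m + 1) =
      insert m (Finset.univ.filter (fun j : Fin k => (j : ℕ) < m)) := by
    ext l
    simp only [Finset.mem_filter, Finset.mem_univ, true_and, Finset.mem_insert, Fin.ext_iff]
    omega
  have h1 : ∑ j ∈ Finset.univ.filter (fun j : Fin k => (j : ℕ) < m + 1), Real.exp (z j / r) ≤
      (∑ j ∈ Finset.univ.filter (fun j : Fin k => (j : ℕ) < m), Real.exp (z j / r)) *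
        (1 + θ) := by
    rw [hfilter, Finset.sum_insert (by simp)]
    nlinarith [mul_le_mul_of_nonneg_left (exp_le_sum_smaxLE (r := r) (z := z) hj) hθ.le]
  have h2 := Real.log_le_log (sum_smaxLE_pos (by omega) hk) h1
  rw [Real.log_mul hS.ne' (by positivity)] at h2
  have h3 := Real.log_le_sub_one_of_pos (by positivity : 0 < 1 + θ)
  rw [smaxLE, smaxLE, ← mul_add]
  exact mul_le_mul_of_nonneg_left (by linarith) hr.le

end Smax

/-! ### The functions -/

section Functions

variable {n p : ℕ}

theorem abs_inner_frame_sub_le {k : ℕ} (V : Frame n k) (j : Fin k) (x y : E n) :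
    |inner ℝ (V.1 j) x - inner ℝ (V.1 j) y| ≤ dist x y := by
  rw [← inner_sub_right, dist_eq_norm]
  simpa [V.2.1 j] using abs_real_inner_le_norm (V.1 j) (x - y)

theorem fFun_le_add_dist (h : 1 ≤ kk n) (V : Frame n (kk n)) {i : ℕ} (hi : 0 < i) (x y : E n) :
    fFun p i V x ≤ fFun p i V y + dist x y := by
  have := smaxLE_le_add (z := vecV V x) (w := vecV V y) (δ := dist x y) (rho_pos h p) hi h
    fun j => by
      have := (abs_le.1 (abs_inner_frame_sub_le V j x y)).2
      unfold vecV
      linarith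
  unfold fFun
  linarith

theorem fFun_le_hFun {k : ℕ} (V : Frame n k) {i m : ℕ} (hm : 1 ≤ m) (hmi : m ≤ i) (x : E n) :
    fFun p m V x ≤ hFun p i V x := by
  have := le_ciSup (f := fun j : Fin i => fFun p ((j : ℕ) + 1) V x) (Set.finite_range _).bddAbove
    ⟨m - 1, by omega⟩
  rwa [show ((⟨m - 1, by omega⟩ : Fin i) : ℕ) + 1 = m from Nat.sub_add_cancel hm] at this

theorem hFun_le {k : ℕ} (V : Frame n k) {i : ℕ} (hi : 1 ≤ i) {x : E n} {c : ℝ}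
    (h : ∀ m, 1 ≤ m → m ≤ i → fFun p m V x ≤ c) : hFun p i V x ≤ c := by
  have : Nonempty (Fin i) := ⟨⟨0, hi⟩⟩
  exact ciSup_le fun j => h _ (by omega) (by omega)

theorem lipschitzWith_hFun (h : 1 ≤ kk n) (V : Frame n (kk n)) {i : ℕ} (hi : 1 ≤ i) :
    LipschitzWith 1 (hFun p i V) :=
  LipschitzWith.of_le_add fun x y => hFun_le V hi fun _ hm hmi =>
    (fFun_le_add_dist h V hm x y).trans (add_le_add_left (fFun_le_hFun V hm hmi y) _)

theorem contDiff_gFun (h : 1 ≤ kk n) (V : Frame n (kk n)) {i : ℕ} (hi : 1 ≤ i) :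
    ContDiff ℝ p (gFun p i V) :=
  (lipschitzDerivs_smooth (bet_pos h) (lipschitzWith_hFun h V hi) p).contDiff

theorem gFun_congr {k : ℕ} {V W : Frame n k} {i : ℕ}
    (h : ∀ j : Fin k, (j : ℕ) < i → V.1 j = W.1 j) : gFun p i V = gFun p i W := by
  have hh : hFun p i V = hFun p i W := by
    funext x
    refine iSup_congr fun m => ?_
    unfold fFun smaxLE
    congr 3
    refine Finset.sum_congr rfl fun j hj => ?_
    rw [Finset.mem_filter] at hj
    unfold vecV
    rw [h j (by omega)]
  rw [gFun, gFun, hh]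

/-- As `γ/100 = ρ α ln n`, the gap becomes the ratio `n^{-α}` of exponentials; the softmax rises by
at most `ρ n^{-α}`, which the correction term gives back. -/
theorem fFun_succ_le (h : 1 ≤ kk n) (V : Frame n (kk n)) {j m : Fin (kk n)} (hj : (j : ℕ) < m)
    {y : E n} (hy : vecV V y m + gam n / 100 ≤ vecV V y j) :
    fFun p (m + 1) V y ≤ fFun p m V y := by
  have hr := rho_pos h p
  have hn := pos_of_one_le_kk h
  have hexp : Real.exp (vecV V y m / rho n p) ≤
      (n : ℝ) ^ (-alp p) * Real.exp (vecV V y j / rho n p) := by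
    rw [Real.rpow_def_of_pos hn, ← Real.exp_add]
    refine Real.exp_le_exp.2 ?_
    rw [div_le_iff₀ hr, add_mul, div_mul_cancel₀ _ hr.ne']
    have := rho_mul_alp_mul_log h p
    linarith
  have := smaxLE_succ_le hr hj hexp
  unfold fFun
  push_cast
  linarith

theorem fFun_le_of_small (h : 1 ≤ kk n) (V : Frame n (kk n)) {t : ℕ} {x : E n}
    (hx : ∀ j : Fin (kk n), t ≤ (j : ℕ) → |inner ℝ (V.1 j) x| < gam n / 4) {y : E n}
    (hy : y ∈ Metric.ball x (bet n)) {m : ℕ} (htm : t + 1 ≤ m) (hm : m ≤ kk n) :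
    fFun p m V y ≤ fFun p (t + 1) V y := by
  induction m, htm using Nat.le_induction with
  | base => exact le_rfl
  | succ m htm ih =>
    refine le_trans ?_ (ih (by omega))
    refine fFun_succ_le h V (j := ⟨t, by omega⟩) (m := ⟨m, by omega⟩) htm ?_
    -- `γ/4` comes from `x`, and `γ/8` from moving by less than `β`. Two such errors still leave
    -- `γ/4` of the shift `γ`.
    have hsmall : ∀ j : Fin (kk n), t ≤ (j : ℕ) →
        |inner ℝ (V.1 j) y| ≤ gam n / 4 + gam n / 8 := fun j hj => by
      have h1 := hx j hj
      have h2 := abs_inner_frame_sub_le V j y x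
      have h3 := abs_sub_abs_le_abs_sub (inner ℝ (V.1 j) y) (inner ℝ (V.1 j) x)
      have h4 := bet_le h
      rw [Metric.mem_ball] at hy
      linarith
    have h1 := (abs_le.1 (hsmall ⟨t, by omega⟩ le_rfl)).1
    have h2 := (abs_le.1 (hsmall ⟨m, by omega⟩ (by simp only; omega))).2
    have h3 := gam_pos h
    have h4 : (t : ℝ) + 1 ≤ m := by exact_mod_cast htm
    unfold vecV
    nlinarith

theorem hFun_eq_of_small (h : 1 ≤ kk n) (V : Frame n (kk n)) {t : ℕ} (ht : t + 1 < kk n) {x : E n}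
    (hx : ∀ j : Fin (kk n), t ≤ (j : ℕ) → |inner ℝ (V.1 j) x| < gam n / 4) {y : E n}
    (hy : y ∈ Metric.ball x (bet n)) : hFun p (kk n) V y = hFun p (t + 1) V y := by
  refine le_antisymm (hFun_le V h fun m hm hmk => ?_) (hFun_le V (by omega) fun m hm hmt =>
    fFun_le_hFun V hm (by omega) y)
  rcases le_or_gt m (t + 1) with hmt | hmt
  · exact fFun_le_hFun V hm hmt y
  · exact (fFun_le_of_small h V hx hy hmt.le hmk).trans (fFun_le_hFun V (by omega) le_rfl y)

theorem oracle_gFun_eq_of_small (h : 1 ≤ kk n) (V : Frame n (kk n)) {t : ℕ} (ht : t + 1 < kk n)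
    {x : E n} (hx : ∀ j : Fin (kk n), t ≤ (j : ℕ) → |inner ℝ (V.1 j) x| < gam n / 4) :
    oracle p (gFun p (kk n) V) x = oracle p (gFun p (t + 1) V) x := by
  have hb := bet_pos h
  have heq : gFun p (kk n) V =ᶠ[nhds x] gFun p (t + 1) V :=
    Filter.eventually_of_mem (Metric.ball_mem_nhds x (by positivity : 0 < bet n / 2 ^ p))
      (smooth_congr hb (fun y hy => hFun_eq_of_small h V ht hx hy) p)
  exact funext fun j => (heq.iteratedFDeriv ℝ j).eq_of_nhds

/-- The witness is `-∑ v_j/√k`. The largest shift is `(k-1)γ`; the remaining `γ` pays for `β ≤ γ/8`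
from smoothing, `ρ ln k ≤ γ/100` from the softmax and at most `ρ ≤ γ/100` from the correction. -/
theorem exists_gFun_le (h : 1 ≤ kk n) (V : Frame n (kk n)) :
    ∃ y ∈ Metric.closedBall (0 : E n) 1,
      gFun p (kk n) V y ≤ -(1 / √(kk n)) + kk n * gam n := by
  have hk : (0 : ℝ) < kk n := by exact_mod_cast h
  have hs : 0 < √(kk n : ℝ) := Real.sqrt_pos.2 hk
  have hb := bet_pos h
  let y : E n := ∑ j, (-(1 / √(kk n : ℝ))) • V.1 j
  have hinner : ∀ j, inner ℝ (V.1 j) y = -(1 / √(kk n : ℝ)) := fun j =>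
    V.2.inner_right_fintype (fun _ => -(1 / √(kk n : ℝ))) j
  have hnorm : ‖y‖ ^ 2 = 1 := by
    rw [← real_inner_self_eq_norm_sq]
    conv_lhs => enter [2]; rw [show y = ∑ j, (-(1 / √(kk n : ℝ))) • V.1 j from rfl]
    rw [sum_inner]
    simp only [real_inner_smul_left, hinner]
    rw [Finset.sum_const, Finset.card_univ, Fintype.card_fin, nsmul_eq_mul, neg_mul_neg,
      ← sq, div_pow, Real.sq_sqrt hk.le]
    field_simp
  refine ⟨y, ?_, smooth_le_of_forall_mem_ball hb (lipschitzWith_hFun h V h) (fun w hw => ?_) p y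
    (Metric.mem_ball_self (by positivity))⟩
  · rw [mem_closedBall_zero_iff]
    exact (pow_le_one_iff_of_nonneg (norm_nonneg _) two_ne_zero).1 hnorm.le
  · refine hFun_le V h fun m hm hmk => ?_
    have hr := rho_pos h p
    have h1 := smaxLE_le_of_le (z := vecV V w) (i := m) hr hm h
      (c := -(1 / √(kk n : ℝ)) + bet n + (kk n - 1) * gam n) fun j => by
        have h2 := (abs_le.1 (abs_inner_frame_sub_le V j w y)).2
        rw [hinner] at h2
        rw [Metric.mem_ball] at hw
        have h3 : ((kk n : ℝ) - ((j : ℕ) + 1)) * gam n ≤ (kk n - 1) * gam n :=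
          mul_le_mul_of_nonneg_right
            (by linarith [(Nat.cast_nonneg (j : ℕ) : (0 : ℝ) ≤ (j : ℕ))]) (gam_nonneg n)
        unfold vecV
        linarith
    have hlog : rho n p * Real.log (kk n) ≤ rho n p * Real.log n :=
      mul_le_mul_of_nonneg_left
        (Real.log_le_log hk (by exact_mod_cast kk_le n)) hr.le
    have h4 := rho_mul_log_le h p
    have h5 : rho n p * 1 ≤ rho n p * Real.log n :=
      mul_le_mul_of_nonneg_left (by linarith [eight_le_log h]) hr.le
    have h6 : rho n p * ((kk n : ℝ) - m) * (n : ℝ) ^ (-alp p) ≤ rho n p * 1 := by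
      rw [mul_assoc]
      refine mul_le_mul_of_nonneg_left (le_trans ?_ (kk_mul_rpow_le_one h p)) hr.le
      gcongr
      linarith [(Nat.cast_nonneg m : (0 : ℝ) ≤ m)]
    have h7 := bet_le h
    have h8 := gam_pos h
    unfold fFun
    linarith

/-- The last coordinate has shift 0, and the linear lower bound survives smoothing. -/
theorem inner_le_gFun (h : 1 ≤ kk n) (V : Frame n (kk n)) {j : Fin (kk n)}
    (hj : (j : ℕ) + 1 = kk n) (x : E n) : inner ℝ (V.1 j) x ≤ gFun p (kk n) V x := by
  refine inner_le_smooth (bet_pos h) (lipschitzWith_hFun h V h) (fun y => ?_) p x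
  refine le_trans ?_ (fFun_le_hFun V h le_rfl y)
  have h1 := le_smaxLE (z := vecV V y) (i := kk n) (rho_pos h p) j.2
  have h2 : vecV V y j = inner ℝ (V.1 j) y := by
    have : ((kk n : ℝ) - ((j : ℕ) + 1)) = 0 := by
      rw [sub_eq_zero]
      exact_mod_cast hj.symm
    rw [vecV, this, zero_mul, add_zero]
  rw [h2] at h1
  unfold fFun
  linarith

/-- A correct output has `⟨v_k, x⟩ ≤ -1/√k + kγ + ε ≤ -0.8/√k ≤ -8γ`, using `γ ≤ kγ ≤ 0.1/√k`. -/
theorem le_abs_inner_of_isApproxMin (h : 1 ≤ kk n) (V : Frame n (kk n)) {j : Fin (kk n)}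
    (hj : (j : ℕ) + 1 = kk n) {x : E n} (hx : IsApproxMin (eps n) (gFun p (kk n) V) x) :
    gam n / 4 ≤ |inner ℝ (V.1 j) x| := by
  by_contra! hlt
  have hk : (1 : ℝ) ≤ kk n := by exact_mod_cast h
  obtain ⟨y, hy, hyle⟩ := exists_gFun_le (p := p) h V
  have h1 := hx.2 y hy
  have h2 := inner_le_gFun (p := p) h V hj x
  have h3 := (abs_lt.1 hlt).1
  have h4 := kk_mul_gam_mul_sqrt_le h
  have h5 : gam n ≤ kk n * gam n := le_mul_of_one_le_left (gam_nonneg n) hk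
  have h6 : 0.1 / √(kk n : ℝ) = 0.1 * (1 / √(kk n)) := by ring
  have h7 := gam_pos h
  rw [eps] at h1
  rw [h6] at h1 h4
  linarith

end Functions

/-! ### Probability bounds for hiding and hardness -/

theorem haarFrameGiven_oracle_ne_le {n p : ℕ} (h : 1 ≤ kk n) {t : ℕ} (ht : t + 1 < kk n)
    (V : Frame n (kk n)) {x : E n} (hx : ‖x‖ ≤ 1) :
    (haarFrameGiven t V).real {U |
      oracle p (gFun p (kk n) U) x ≠ oracle p (gFun p (t + 1) U) x} ≤ (n : ℝ) ^ (-10 : ℤ) := by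
  have hg : 0 ≤ gam n / 4 := div_nonneg (gam_nonneg n) (by norm_num)
  have hkn := kk_le n
  let S := Finset.univ.filter fun j : Fin (kk n) => t ≤ (j : ℕ)
  have hsub : {U : Frame n (kk n) |
      oracle p (gFun p (kk n) U) x ≠ oracle p (gFun p (t + 1) U) x} ⊆
      ⋃ j ∈ S, {U : Frame n (kk n) | gam n / 4 ≤ |inner ℝ (U.1 j) x|} := by
    intro U hU
    by_contra hcon
    simp only [S, Finset.mem_filter, Finset.mem_univ, true_and, Set.mem_iUnion,
      Set.mem_ofPred_eq, not_exists, not_le] at hcon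
    exact hU (oracle_gFun_eq_of_small h U ht hcon)
  refine (measureReal_mono hsub (measure_ne_top _ _)).trans
    ((measureReal_biUnion_finset_le _ _).trans ?_)
  refine le_trans (Finset.sum_le_sum fun j hj =>
    haarFrameGiven_abs_inner_ge_le V (by omega) (Finset.mem_filter.1 hj).2 hx hg) ?_
  refine le_trans ?_ (two_mul_kk_mul_exp_le h (t := t) (by omega))
  rw [Finset.sum_const, nsmul_eq_mul, mul_comm (2 : ℝ) (kk n : ℝ), mul_assoc]
  refine mul_le_mul_of_nonneg_right ?_ (mul_nonneg zero_le_two (Real.exp_pos _).le)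
  exact_mod_cast (Finset.card_filter_le _ _).trans (Finset.card_fin _).le

theorem haarFrameGiven_isApproxMin_le {n p : ℕ} (h : 1 ≤ kk n) {t : ℕ} (ht : t + 1 = kk n)
    (V : Frame n (kk n)) (x : E n) :
    (haarFrameGiven t V).real {U | IsApproxMin (eps n) (gFun p (kk n) U) x} ≤
      (n : ℝ) ^ (-10 : ℤ) := by
  have hg : 0 ≤ gam n / 4 := div_nonneg (gam_nonneg n) (by norm_num)
  have hkn := kk_le n
  by_cases hx : ‖x‖ ≤ 1
  · have hsub : {U : Frame n (kk n) | IsApproxMin (eps n) (gFun p (kk n) U) x} ⊆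
        {U : Frame n (kk n) | gam n / 4 ≤ |inner ℝ (U.1 ⟨t, by omega⟩) x|} := fun U hU =>
      le_abs_inner_of_isApproxMin h U ht hU
    have h1 := haarFrameGiven_abs_inner_ge_le V (t := t) (j := ⟨t, by omega⟩) (by omega) le_rfl
      hx hg
    have h2 := two_mul_kk_mul_exp_le h (t := t) (by omega)
    have hk : (1 : ℝ) ≤ kk n := by exact_mod_cast h
    have h3 := mul_le_mul_of_nonneg_right (by linarith : 2 ≤ 2 * (kk n : ℝ))
      (Real.exp_pos (-((n - t) * (gam n / 4) ^ 2 / 2))).le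
    exact (measureReal_mono hsub (measure_ne_top _ _)).trans (h1.trans (h3.trans h2))
  -- Outside the unit ball no point is a correct output.
  · have hempty : {U : Frame n (kk n) | IsApproxMin (eps n) (gFun p (kk n) U) x} = ∅ :=
      Set.eq_empty_of_forall_notMem fun U hU => hx (mem_closedBall_zero_iff.1 hU.1)
    rw [hempty, measureReal_empty]
    exact zpow_nonneg n.cast_nonneg _

theorem isInformationHiding_gFun {n p : ℕ} (h : 1 ≤ kk n) :
    IsInformationHiding (kk n) (haarFrame (kk_le n)) (fun j (V : Frame n (kk n)) => V.1 j)
      haarFrameGiven (gFun p) (oracle p) (Metric.closedBall (0 : E n) 1) (IsApproxMin (eps n))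
      ((n : ℝ) ^ (-10 : ℤ)) ((n : ℝ) ^ (-10 : ℤ)) where
  isProb := inferInstance
  measurable := measurable_frame_apply
  determined _ _ _ _ _ hVW := gFun_congr hVW
  condLaw t _ := isCondLaw_haarFrameGiven (kk_le n) t
  hides _ ht V _ hx := haarFrameGiven_oracle_ne_le h ht V (mem_closedBall_zero_iff.1 hx)
  hard _ ht V x := haarFrameGiven_isApproxMin_le h ht V x

end HiddenOpt

end

theorem mainTheorem6 (n p : ℕ) :
    (∀ i, 1 ≤ i → i ≤ HiddenOpt.kk n → ∀ V : HiddenOpt.Frame n (HiddenOpt.kk n),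
      ContDiff ℝ p (HiddenOpt.gFun p i V)) ∧
    HiddenOpt.IsInformationHiding (HiddenOpt.kk n)
      (HiddenOpt.haarFrame (HiddenOpt.kk_le n))
      (fun j (V : HiddenOpt.Frame n (HiddenOpt.kk n)) => V.1 j)
      HiddenOpt.haarFrameGiven
      (HiddenOpt.gFun p)
      (HiddenOpt.oracle p)
      (Metric.closedBall (0 : HiddenOpt.E n) 1)
      (HiddenOpt.IsApproxMin (HiddenOpt.eps n))
      ((n : ℝ) ^ (-10 : ℤ)) ((n : ℝ) ^ (-10 : ℤ)) := by
  refine ⟨fun i hi hik V => HiddenOpt.contDiff_gFun (hi.trans hik) V hi, ?_⟩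
  rcases Nat.eq_zero_or_pos (HiddenOpt.kk n) with h0 | h
  · exact
      { isProb := inferInstance
        measurable := HiddenOpt.measurable_frame_apply
        determined := fun i hi hik => absurd (hi.trans hik) (by omega)
        condLaw := fun t ht => absurd ht (by omega)
        hides := fun t ht => absurd ht (by omega)
        hard := fun t ht => absurd ht (by omega) }
  · exact HiddenOpt.isInformationHiding_gFun h
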